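/- Let $N\ge 1$, $d\ge 0$, $T>0$, and let $b:\mathbb R^d\times\mathcal P(\mathbb R^d)\to\mathbb R^d$ be measurable. For $\mu\in\mathcal P(\mathbb R^d)$ put $L_\mu\varphi(x)=\langle b(x,\mu),\nabla\varphi(x)\rangle+\tfrac12\Delta\varphi(x)$, and for $\mathbf x=(x^1,\dots,x^N)\in(\mathbb R^d)^N$ put $\mu_{\mathbf x}=\frac1N\sum_i\delta_{x^i}$ and $\mathcal L_N\varphi(\mathbf x)=\sum_{i=1}^N (L_{\mu_{\mathbf x}}\diamond_i\varphi)(\mathbf x)$, where $L\diamond_i\varphi$ is $L$ acting on the $i$-th variable. Let $(\mathcal X^N_s)_{0\le s\le T}$, $\mathcal X^N_s=(X^1_s,\dots,X^N_s)$, be a McKean–Vlasov particle system with drift $b$ and diffusion matrix $\sigma=I_d$, i.e. an adapted process with continuous paths on a filtered probability space, with exchangeable time marginals, which solves the martingale problem of $\mathcal L_N$: for every $\varphi\in C^2_c((\mathbb R^d)^N)$, $(s,\omega)\mapsto\mathcal L_N\varphi(\mathcal X^N_s(\omega))$ is integrable on $[0,T]\times\Omega$ and $\varphi(\mathcal X^N_s)-\varphi(\mathcal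 X^N_0)-\int_0^s\mathcal L_N\varphi(\mathcal X^N_r)\,dr$ is a martingale. Let $f^N_s$ be the law of $\mathcal X^N_s$. Let $(f_s)$ be a weak solution on $(0,T)$ of $\partial_t f_t=-\nabla\cdot(b(\cdot,f_t)f_t)+\frac12\Delta f_t$: for all $s\in(0,T)$ and $\varphi\in C^2_c(\mathbb R^d)$, $L_{f_s}\varphi\in L^1(f_s)$ and $\frac{d}{ds}\langle f_s,\varphi\rangle=\langle f_s,L_{f_s}\varphi\rangle$. Assume the following regularity. For $s\in(0,T)$ the measures $f^N_s$ and $f_s$ have positive Lebesgue densities $p_s$ and $u_s$ which are $C^2$ in space and differentiable in time, the densities and their time derivatives being jointly continuous on $(0,T)\times(\mathbb R^d)^N$, respectively $(0,T)\times\mathbb R^d$. Write $h_s=p_s/u_s^{\otimes N}$. Fix $t\in(0,T)$ such that * the relative entropy $H(f^N_t|f_t^{\otimes N})$ and $\mathbb E\big[|b(X^1_t,\mu_{\mathcal X^N_t})-b(X^1_t,f_t)|^2\big]$ are finite; * there is a Lebesgue-integrable function $g$ on $(\mathbb R^d)^N$ with $|\partial_s(p_s\log h_s)(\mathbf x)|\le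 g(\mathbf x)$ for all $s$ in a neighbourhood of $t$ and all $\mathbf x$; * for every $i$, $\mathbb E\Big[\dfrac{|b(X^i_t,\mu_{\mathcal X^N_t})|\,|\log h_t(\mathcal X^N_t)|}{1+|\mathcal X^N_t|}\Big]<\infty$ (this follows from the finiteness of the entropy if $|b(x^i,\mu_{\mathbf x})|\le C(1+|\mathbf x|)$ for all $i$ and $\mathbf x$). Then $H(f^N_s|f_s^{\otimes N})$ is finite for $s$ near $t$ and differentiable in $s$ at $s=t$, the Fisher information $I(f^N_t|f_t^{\otimes N})=\int|\nabla\log h_t|^2\,df^N_t$ is finite, and for every $\alpha>0$ \[ \frac{d}{dt}H\big(f^N_t\big|f_t^{\otimes N}\big)\le\frac{\alpha-1}{2}\,I\big(f^N_t\big|f_t^{\otimes N}\big)+\frac{N}{2\alpha}\,\mathbb E\Big[\big|b(X^1_t,\mu_{\mathcal X^N_t})-b(X^1_t,f_t)\big|^2\Big]. \] -/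

import Mathlib

open MeasureTheory ProbabilityTheory InformationTheory Set Filter Topology
open scoped ENNReal InnerProductSpace

/-- The one-particle state space `ℝ^d` with its Euclidean norm. -/
abbrev Space (d : ℕ) : Type := EuclideanSpace ℝ (Fin d)

/-- The space `(ℝ^d)^N` of configurations `(x¹, …, x^N)` of `N` particles. -/
abbrev Config (N d : ℕ) : Type := Fin N → Space d

noncomputable section

/-- The empirical measure `(1/N) ∑ᵢ δ_{xⁱ}` of a configuration. -/
def empiricalMeasure {N d : ℕ} [NeZero N] (x : Config N d) : ProbabilityMeasure (Space d) :=
  ⟨(N : ℝ≥0∞)⁻¹ • ∑ i : Fin N, Measure.dirac (x i), ⟨by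
    have hN : (N : ℝ≥0∞) ≠ 0 := by exact_mod_cast NeZero.ne N
    simp [ENNReal.inv_mul_cancel hN (ENNReal.natCast_ne_top N)]⟩⟩

/-- The generator `L_μ φ = ⟨b(·, μ), ∇φ⟩ + ½ Δφ` with drift `b` and diffusion matrix `I_d`. -/
def generator {d : ℕ} (b : Space d → ProbabilityMeasure (Space d) → Space d)
    (μ : ProbabilityMeasure (Space d)) (φ : Space d → ℝ) (x : Space d) : ℝ :=
  ⟪b x μ, gradient φ x⟫_ℝ + (1 / 2 : ℝ) * Laplacian.laplacian φ x

/-- The function of the single variable `y` obtained from `φ` by replacing the `i`-th particle of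
`x` by `y`. -/
def slice {N d : ℕ} (φ : Config N d → ℝ) (i : Fin N) (x : Config N d) : Space d → ℝ :=
  fun y => φ (Function.update x i y)

/-- The generator `𝓛_N φ (x) = ∑ᵢ (L_{μ_x} ⋄ᵢ φ)(x)` of the mean-field `N`-particle system, where
`L ⋄ᵢ φ` is `L` acting on the `i`-th variable of `φ` and `μ_x` is the empirical measure. -/
def particleGenerator {N d : ℕ} [NeZero N]
    (b : Space d → ProbabilityMeasure (Space d) → Space d)
    (φ : Config N d → ℝ) (x : Config N d) : ℝ :=
  ∑ i : Fin N, generator b (empiricalMeasure x) (slice φ i x) (x i)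

/-- `X` is an (exchangeable) McKean–Vlasov particle system on `[0, T]` with drift `b` and diffusion
matrix `I_d`, on the filtered probability space `(Ω, ℱ, P)`: an adapted continuous process, with
exchangeable time marginals, which solves the martingale problem of the `N`-particle generator.
Only the values `X s` for `s ∈ [0, T]` matter. -/
structure IsParticleSystem {N d : ℕ} [NeZero N] {Ω : Type*} {mΩ : MeasurableSpace Ω}
    (b : Space d → ProbabilityMeasure (Space d) → Space d) (T : ℝ)
    (ℱ : Filtration (Icc (0 : ℝ) T) mΩ) (P : Measure Ω) (X : ℝ → Ω → Config N d) : Prop where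
  adapted : ∀ t : Icc (0 : ℝ) T, Measurable[ℱ t] (X t)
  continuous_paths : ∀ᵐ ω ∂P, ContinuousOn (fun t => X t ω) (Icc 0 T)
  exchangeable : ∀ t ∈ Icc (0 : ℝ) T, ∀ τ : Equiv.Perm (Fin N),
    P.map (fun ω => X t ω ∘ τ) = P.map (X t)
  integrable : ∀ φ : Config N d → ℝ, ContDiff ℝ 2 φ → HasCompactSupport φ →
    Integrable (fun z : ℝ × Ω => particleGenerator b φ (X z.1 z.2))
      ((volume.restrict (Icc (0 : ℝ) T)).prod P)
  martingale : ∀ φ : Config N d → ℝ, ContDiff ℝ 2 φ → HasCompactSupport φ →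
    Martingale (fun (t : Icc (0 : ℝ) T) ω =>
      φ (X t ω) - φ (X 0 ω) - ∫ s in (0 : ℝ)..t, particleGenerator b φ (X s ω)) ℱ P

/-- `f` is a weak solution on `(0, T)` of the nonlinear Fokker–Planck (McKean–Vlasov) equation
`∂ₜ fₜ = -∇·(b(·, fₜ) fₜ) + ½ Δ fₜ`. -/
structure IsMcKeanVlasovSolution {d : ℕ} (b : Space d → ProbabilityMeasure (Space d) → Space d)
    (T : ℝ) (f : ℝ → ProbabilityMeasure (Space d)) : Prop where
  integrable : ∀ t ∈ Ioo (0 : ℝ) T, ∀ φ : Space d → ℝ, ContDiff ℝ 2 φ → HasCompactSupport φ →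
    Integrable (generator b (f t) φ) (f t : Measure (Space d))
  hasDerivAt : ∀ t ∈ Ioo (0 : ℝ) T, ∀ φ : Space d → ℝ, ContDiff ℝ 2 φ → HasCompactSupport φ →
    HasDerivAt (fun s => ∫ x, φ x ∂(f s : Measure (Space d)))
      (∫ x, generator b (f t) φ x ∂(f t : Measure (Space d))) t

/-- On the time interval `(0, T)`, the measures `μ s` have the positive densities `ρ s` with respect
to Lebesgue measure, and these are `C¹` in time and `C²` in space. -/
structure IsRegularDensity {G : Type*} [NormedAddCommGroup G] [NormedSpace ℝ G]
    [MeasureSpace G] (T : ℝ) (μ : ℝ → Measure G) (ρ : ℝ → G → ℝ) : Prop where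
  eq_withDensity : ∀ s ∈ Ioo (0 : ℝ) T,
    μ s = (volume : Measure G).withDensity (fun x => ENNReal.ofReal (ρ s x))
  pos : ∀ s ∈ Ioo (0 : ℝ) T, ∀ x, 0 < ρ s x
  contDiff : ∀ s ∈ Ioo (0 : ℝ) T, ContDiff ℝ 2 (ρ s)
  continuousOn : ContinuousOn (fun z : ℝ × G => ρ z.1 z.2) (Ioo 0 T ×ˢ univ)
  differentiableAt : ∀ s ∈ Ioo (0 : ℝ) T, ∀ x, DifferentiableAt ℝ (fun r => ρ r x) s
  continuousOn_deriv :
    ContinuousOn (fun z : ℝ × G => deriv (fun r => ρ r z.2) z.1) (Ioo 0 T ×ˢ univ)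

/-- The ratio `p(s, x) / ∏ᵢ u(s, xⁱ)` of the density `p` of the `N`-particle law and of the
tensorized density `u`. -/
def densityRatio {N d : ℕ} (p : ℝ → Config N d → ℝ) (u : ℝ → Space d → ℝ) (s : ℝ)
    (x : Config N d) : ℝ :=
  p s x / ∏ i : Fin N, u s (x i)

/-- The Fisher information `I(ν | μ) = ∫ |∇ log (dν/dμ)|² dν` on `(ℝ^d)^N`, computed with a `C¹`
version of `dν/dμ`, where `|∇g|² = ∑ᵢ |∇_{xⁱ} g|²`. It is `+∞` if there is no such version, in
particular if `ν` is not absolutely continuous. (The version is unique, so that the infimum is over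
at most one element, as soon as `μ` charges every nonempty open set.) -/
def fisherInformation {N d : ℕ} (ν μ : Measure (Config N d)) : ℝ≥0∞ :=
  ⨅ (h : Config N d → ℝ) (_ : ContDiff ℝ 1 h ∧ (∀ x, 0 ≤ h x) ∧
      ν = μ.withDensity (fun x => ENNReal.ofReal (h x))),
    ∫⁻ x, ENNReal.ofReal
      (∑ i : Fin N, ‖gradient (slice (fun y => Real.log (h y)) i x) (x i)‖ ^ 2) ∂ν

/-- The tensor power `f^{⊗N}` of a probability measure on `ℝ^d`. -/
def tensorPower {d : ℕ} (N : ℕ) (f : ProbabilityMeasure (Space d)) : Measure (Config N d) :=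
  Measure.pi (fun _ : Fin N => (f : Measure (Space d)))

end

/-! Write `U = u^{⊗N}` and `ℓ = log h`, so that `p = U e^ℓ`, and let `βᵢ` be the drift of particle
`i` minus the limit drift at the same point. Pointwise, `∂ₜ(p log h) = (ℓ + 1) ∂ₜp - e^ℓ ∂ₜU`.
Inserting the Fokker–Planck equations of `p` and `U`, tested against `ℓ + 1` and `e^ℓ`, makes the
second derivatives of `ℓ` cancel and leaves the dissipation identity `dH/dt = 𝔼[∑ᵢ ⟨βᵢ, ∇ᵢℓ⟩ - ½ ∑ᵢ
|∇ᵢℓ|²]`. Young's inequality `⟨β, v⟩ ≤ (α/2)|v|² + |β|²/(2α)` and exchangeability then give the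
bound.

The drift is only measurable and both equations are weak, so the test functions are cut off: `χ(ℓ +
1)` and `χ e^ℓ` are `C²` with compact support because the densities are positive and `C²`. The
cancellation is then pointwise algebra (`entropy_dissipation_identity`), without integration by
parts. The weak equations at the fixed time `t` are `IsParticleSystem.integral_deriv_density` and
`IsMcKeanVlasovSolution.integral_deriv_tensorDensity`; `integral_cutoff_mul_deriv_entropy_density`
combines them.

Removing the cutoff has two sides. The terms with derivatives of `χ` vanish in the limit; the worst
one, `ℓ ⟨b, ∇χ⟩`, is dominated because `|∇χₙ| ≤ C/(1 + |x|)` matches the growth hypothesis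
(`tendsto_integral_cutoff_remainder`). The Fisher information is not known to be finite beforehand:
the truncated dissipation integrals converge to `dH/dt`, Young's inequality absorbs the cross term,
and Fatou's lemma bounds the Fisher information; only then does dominated convergence identify the
limit (`integrable_and_integral_eq_of_tendsto_cutoff`). The domination hypothesis serves to
differentiate the entropy under the integral (`hasDerivAt_entropy`). -/

noncomputable section

/-! ### Product and exponential rules for the gradient and the Laplacian. -/

section Calculus

variable {d : ℕ}

lemma laplacian_eq_sum_fderiv_fderiv (φ : Space d → ℝ) (x : Space d) :
    Laplacian.laplacian φ x =
      ∑ k, fderiv ℝ (fderiv ℝ φ) x (EuclideanSpace.basisFun (Fin d) ℝ k)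
        (EuclideanSpace.basisFun (Fin d) ℝ k) := by
  rw [InnerProductSpace.laplacian_eq_iteratedFDeriv_orthonormalBasis φ
    (EuclideanSpace.basisFun (Fin d) ℝ)]
  simp only [iteratedFDeriv_two_apply]
  simp

lemma inner_gradient_eq_sum (φ ψ : Space d → ℝ) (x : Space d) :
    ⟪gradient φ x, gradient ψ x⟫_ℝ =
      ∑ k, fderiv ℝ φ x (EuclideanSpace.basisFun (Fin d) ℝ k) *
        fderiv ℝ ψ x (EuclideanSpace.basisFun (Fin d) ℝ k) := by
  rw [← (EuclideanSpace.basisFun (Fin d) ℝ).sum_inner_mul_inner (gradient φ x) (gradient ψ x)]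
  refine Finset.sum_congr rfl fun k _ => ?_
  rw [inner_gradient_left, inner_gradient_right]
  simp

lemma gradient_mul {φ ψ : Space d → ℝ} {x : Space d} (hφ : DifferentiableAt ℝ φ x)
    (hψ : DifferentiableAt ℝ ψ x) :
    gradient (fun y => φ y * ψ y) x = φ x • gradient ψ x + ψ x • gradient φ x := by
  simp only [gradient]
  rw [fderiv_fun_mul hφ hψ]
  simp

lemma gradient_exp {φ : Space d → ℝ} {x : Space d} (hφ : DifferentiableAt ℝ φ x) :
    gradient (fun y => Real.exp (φ y)) x = Real.exp (φ x) • gradient φ x := by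
  simp only [gradient]
  rw [fderiv_exp hφ]
  simp

lemma laplacian_mul {φ ψ : Space d → ℝ} (hφ : ContDiff ℝ 2 φ) (hψ : ContDiff ℝ 2 ψ)
    (x : Space d) :
    Laplacian.laplacian (fun y => φ y * ψ y) x =
      φ x * Laplacian.laplacian ψ x + ψ x * Laplacian.laplacian φ x
        + 2 * ⟪gradient φ x, gradient ψ x⟫_ℝ := by
  have dφ : Differentiable ℝ φ := hφ.differentiable two_ne_zero
  have dψ : Differentiable ℝ ψ := hψ.differentiable two_ne_zero
  have ddφ : Differentiable ℝ (fderiv ℝ φ) :=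
    (hφ.fderiv_right (m := 1) le_rfl).differentiable one_ne_zero
  have ddψ : Differentiable ℝ (fderiv ℝ ψ) :=
    (hψ.fderiv_right (m := 1) le_rfl).differentiable one_ne_zero
  have h1 : fderiv ℝ (fun y => φ y * ψ y) =
      fun y => φ y • fderiv ℝ ψ y + ψ y • fderiv ℝ φ y :=
    funext fun y => fderiv_fun_mul (dφ y) (dψ y)
  rw [inner_gradient_eq_sum, laplacian_eq_sum_fderiv_fderiv, laplacian_eq_sum_fderiv_fderiv,
    laplacian_eq_sum_fderiv_fderiv, h1,
    fderiv_fun_add ((dφ x).fun_smul (ddψ x)) ((dψ x).fun_smul (ddφ x)),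
    fderiv_fun_smul (dφ x) (ddψ x), fderiv_fun_smul (dψ x) (ddφ x), Finset.mul_sum, Finset.mul_sum,
    Finset.mul_sum, ← Finset.sum_add_distrib, ← Finset.sum_add_distrib]
  refine Finset.sum_congr rfl fun k _ => ?_
  simp
  ring

lemma laplacian_exp {φ : Space d → ℝ} (hφ : ContDiff ℝ 2 φ) (x : Space d) :
    Laplacian.laplacian (fun y => Real.exp (φ y)) x =
      Real.exp (φ x) * (Laplacian.laplacian φ x + ‖gradient φ x‖ ^ 2) := by
  have dφ : Differentiable ℝ φ := hφ.differentiable two_ne_zero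
  have ddφ : Differentiable ℝ (fderiv ℝ φ) :=
    (hφ.fderiv_right (m := 1) le_rfl).differentiable one_ne_zero
  have h1 : fderiv ℝ (fun y => Real.exp (φ y)) = fun y => Real.exp (φ y) • fderiv ℝ φ y :=
    funext fun y => fderiv_exp (dφ y)
  rw [← real_inner_self_eq_norm_sq, inner_gradient_eq_sum, laplacian_eq_sum_fderiv_fderiv,
    laplacian_eq_sum_fderiv_fderiv, h1, fderiv_fun_smul (dφ x).exp (ddφ x), fderiv_exp (dφ x),
    ← Finset.sum_add_distrib, Finset.mul_sum]
  refine Finset.sum_congr rfl fun k _ => ?_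
  simp
  ring

/-- The pointwise identity behind the entropy dissipation: no derivative of the drifts and no
second derivative of `ℓ` is left. -/
lemma entropy_dissipation_identity {c ℓ : Space d → ℝ} (hc : ContDiff ℝ 2 c)
    (hℓ : ContDiff ℝ 2 ℓ) (b₁ b₂ x : Space d) :
    Real.exp (ℓ x) * (⟪b₁, gradient (fun y => c y * (ℓ y + 1)) x⟫_ℝ
        + 1 / 2 * Laplacian.laplacian (fun y => c y * (ℓ y + 1)) x)
      - (⟪b₂, gradient (fun y => c y * Real.exp (ℓ y)) x⟫_ℝ
        + 1 / 2 * Laplacian.laplacian (fun y => c y * Real.exp (ℓ y)) x) =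
    Real.exp (ℓ x) * (c x * (⟪b₁ - b₂, gradient ℓ x⟫_ℝ - 1 / 2 * ‖gradient ℓ x‖ ^ 2)
      + ⟪b₁ - b₂, gradient c x⟫_ℝ + ℓ x * ⟪b₁, gradient c x⟫_ℝ
      + 1 / 2 * (ℓ x * Laplacian.laplacian c x)) := by
  have hℓ1 : ContDiff ℝ 2 fun y => ℓ y + 1 := hℓ.add contDiff_const
  have dc : Differentiable ℝ c := hc.differentiable two_ne_zero
  have dℓ : Differentiable ℝ ℓ := hℓ.differentiable two_ne_zero
  have g1 : gradient (fun y => ℓ y + 1) x = gradient ℓ x := by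
    simp only [gradient, fderiv_add_const]
  have l1 : Laplacian.laplacian (fun y => ℓ y + 1) x = Laplacian.laplacian ℓ x := by
    rw [laplacian_eq_sum_fderiv_fderiv, laplacian_eq_sum_fderiv_fderiv]
    congr 1 with k
    congr 3
    ext1 y
    rw [fderiv_add_const]
  -- The terms `c Δℓ` and `⟨∇c, ∇ℓ⟩` occur in both brackets and cancel. The dissipation `-½ c |∇ℓ|²`
  -- is the extra term in the Laplacian of `exp ℓ`.
  rw [gradient_mul (dc x) ((dℓ x).add_const 1), gradient_mul (dc x) (dℓ x).exp,
    laplacian_mul hc hℓ1, laplacian_mul hc hℓ.exp, laplacian_exp hℓ, gradient_exp (dℓ x), g1, l1]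
  simp only [inner_add_right, inner_sub_left, inner_smul_right]
  ring

end Calculus

/-! ### Derivatives in one particle: regularity, support and scaling. -/

section Slices

variable {N d : ℕ}

/-- The gradient of `φ` with respect to the `i`-th particle. -/
def particleGradient (φ : Config N d → ℝ) (i : Fin N) (x : Config N d) : Space d :=
  gradient (slice φ i x) (x i)

/-- The Laplacian of `φ` with respect to the `i`-th particle. -/
def particleLaplacian (φ : Config N d → ℝ) (i : Fin N) (x : Config N d) : ℝ :=
  Laplacian.laplacian (slice φ i x) (x i)

lemma hasFDerivAt_update_single (x : Config N d) (i : Fin N) (y : Space d) :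
    HasFDerivAt (Function.update x i)
      (ContinuousLinearMap.single ℝ (fun _ : Fin N => Space d) i) y := by
  have h : ContinuousLinearMap.pi (Pi.single i (ContinuousLinearMap.id ℝ (Space d))) =
      ContinuousLinearMap.single ℝ (fun _ : Fin N => Space d) i := by
    ext1 v
    funext j
    by_cases h : j = i
    · subst h; simp
    · simp [h]
  exact h ▸ hasFDerivAt_update (𝕜 := ℝ) x y

lemma ContDiff.slice {n : WithTop ℕ∞} {φ : Config N d → ℝ} (hφ : ContDiff ℝ n φ) (i : Fin N)
    (x : Config N d) : ContDiff ℝ n (slice φ i x) :=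
  hφ.comp (contDiff_update n x i)

lemma HasCompactSupport.slice {φ : Config N d → ℝ} (hφ : HasCompactSupport φ) (i : Fin N)
    (x : Config N d) : HasCompactSupport (slice φ i x) :=
  hφ.comp_isClosedEmbedding (isClosedEmbedding_update x i)

lemma slice_apply_self (φ : Config N d → ℝ) (i : Fin N) (x : Config N d) :
    slice φ i x (x i) = φ x := by
  simp [_root_.slice]

lemma slice_update (φ : Config N d → ℝ) (i : Fin N) (x : Config N d) (y : Space d) :
    slice φ i (Function.update x i y) = slice φ i x := by
  ext z
  simp [_root_.slice]

lemma fderiv_slice {φ : Config N d → ℝ} (hφ : Differentiable ℝ φ) (i : Fin N) (x : Config N d)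
    (y : Space d) :
    fderiv ℝ (slice φ i x) y = (fderiv ℝ φ (Function.update x i y)).comp
      (ContinuousLinearMap.single ℝ (fun _ : Fin N => Space d) i) :=
  ((hφ _).hasFDerivAt.comp y (hasFDerivAt_update_single x i y)).fderiv

lemma continuous_particleGradient {φ : Config N d → ℝ} (hφ : ContDiff ℝ 1 φ) (i : Fin N) :
    Continuous (particleGradient φ i) := by
  have : particleGradient φ i = fun x => (InnerProductSpace.toDual ℝ (Space d)).symm
      ((fderiv ℝ φ x).comp (ContinuousLinearMap.single ℝ (fun _ : Fin N => Space d) i)) := by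
    ext1 x
    rw [particleGradient, gradient, fderiv_slice (hφ.differentiable one_ne_zero),
      Function.update_eq_self]
  rw [this]
  exact (LinearIsometryEquiv.continuous _).comp
    ((hφ.continuous_fderiv one_ne_zero).clm_comp continuous_const)

/-- In terms of the second derivative on the whole configuration space, continuity in `x` is
visible; in the definition the differentiated function itself changes with `x`. -/
lemma particleLaplacian_eq_sum {φ : Config N d → ℝ} (hφ : ContDiff ℝ 2 φ) (i : Fin N)
    (x : Config N d) :
    particleLaplacian φ i x = ∑ k, fderiv ℝ (fderiv ℝ φ) x
      (ContinuousLinearMap.single ℝ (fun _ : Fin N => Space d) i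
        (EuclideanSpace.basisFun (Fin d) ℝ k))
      (ContinuousLinearMap.single ℝ (fun _ : Fin N => Space d) i
        (EuclideanSpace.basisFun (Fin d) ℝ k)) := by
  rw [particleLaplacian, laplacian_eq_sum_fderiv_fderiv]
  refine Finset.sum_congr rfl fun k _ => ?_
  have h1 : fderiv ℝ (slice φ i x) = fun y => (fderiv ℝ φ (Function.update x i y)).comp
      (ContinuousLinearMap.single ℝ (fun _ : Fin N => Space d) i) :=
    funext fun y => fderiv_slice (hφ.differentiable two_ne_zero) i x y
  have ddφ : Differentiable ℝ (fderiv ℝ φ) :=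
    (hφ.fderiv_right (m := 1) le_rfl).differentiable one_ne_zero
  have h2 := ((ddφ (Function.update x i (x i))).hasFDerivAt.comp (x i)
    (hasFDerivAt_update_single x i (x i))).clm_comp
    (hasFDerivAt_const (ContinuousLinearMap.single ℝ (fun _ : Fin N => Space d) i) (x i))
  rw [h1, HasFDerivAt.fderiv (by exact h2)]
  simp only [Function.update_eq_self]
  simp

lemma continuous_particleLaplacian {φ : Config N d → ℝ} (hφ : ContDiff ℝ 2 φ) (i : Fin N) :
    Continuous (particleLaplacian φ i) := by
  rw [show particleLaplacian φ i = _ from funext fun x => particleLaplacian_eq_sum hφ i x]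
  refine continuous_finsetSum _ fun k _ => ?_
  exact (((hφ.fderiv_right (m := 1) le_rfl).continuous_fderiv one_ne_zero).clm_apply
    continuous_const).clm_apply continuous_const

lemma slice_eventuallyEq_zero {φ : Config N d → ℝ} {x : Config N d} (hx : x ∉ tsupport φ)
    (i : Fin N) : slice φ i x =ᶠ[𝓝 (x i)] fun _ => 0 := by
  have h := notMem_tsupport_iff_eventuallyEq.1 hx
  have hc : Tendsto (fun y : Space d => Function.update x i y) (𝓝 (x i)) (𝓝 x) := by
    have := (contDiff_update (𝕜 := ℝ) 0 x i).continuous.tendsto (x i)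
    rwa [Function.update_eq_self] at this
  exact hc.eventually h

lemma particleGradient_eq_zero {φ : Config N d → ℝ} {x : Config N d} (hx : x ∉ tsupport φ)
    (i : Fin N) : particleGradient φ i x = 0 := by
  rw [particleGradient, (slice_eventuallyEq_zero hx i).gradient_eq, gradient_fun_const]

lemma particleLaplacian_eq_zero {φ : Config N d → ℝ} {x : Config N d} (hx : x ∉ tsupport φ)
    (i : Fin N) : particleLaplacian φ i x = 0 := by
  rw [particleLaplacian,
    (InnerProductSpace.laplacian_congr_nhds (slice_eventuallyEq_zero hx i)).eq_of_nhds]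
  simp

lemma hasCompactSupport_particleGradient {φ : Config N d → ℝ} (hφ : HasCompactSupport φ)
    (i : Fin N) : HasCompactSupport (particleGradient φ i) :=
  HasCompactSupport.intro hφ fun _ hx => particleGradient_eq_zero hx i

lemma hasCompactSupport_particleLaplacian {φ : Config N d → ℝ} (hφ : HasCompactSupport φ)
    (i : Fin N) : HasCompactSupport (particleLaplacian φ i) :=
  HasCompactSupport.intro hφ fun _ hx => particleLaplacian_eq_zero hx i

lemma particleGradient_comp_smul {φ : Config N d → ℝ} (c : ℝ) (i : Fin N) (x : Config N d) :
    particleGradient (fun y => φ (c • y)) i x = c • particleGradient φ i (c • x) := by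
  have h : slice (fun y => φ (c • y)) i x = fun y => slice φ i (c • x) (c • y) := by
    ext y
    simp only [_root_.slice, Function.update_smul]
  simp only [particleGradient, h, gradient]
  rw [fderiv_comp_smul]
  simp

lemma particleLaplacian_comp_smul {φ : Config N d → ℝ} (hφ : ContDiff ℝ 2 φ) (c : ℝ) (i : Fin N)
    (x : Config N d) :
    particleLaplacian (fun y => φ (c • y)) i x = c ^ 2 * particleLaplacian φ i (c • x) := by
  have h : slice (fun y => φ (c • y)) i x = fun y => slice φ i (c • x) (c • y) := by
    ext y
    simp only [_root_.slice, Function.update_smul]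
  have h1 : fderiv ℝ (fun y => slice φ i (c • x) (c • y)) =
      fun y => c • fderiv ℝ (slice φ i (c • x)) (c • y) := funext fun y => fderiv_comp_smul ..
  simp only [particleLaplacian, h, laplacian_eq_sum_fderiv_fderiv, Finset.mul_sum, h1]
  refine Finset.sum_congr rfl fun k _ => ?_
  have h2 : fderiv ℝ (fun y => c • fderiv ℝ (slice φ i (c • x)) (c • y)) (x i) =
      c • c • fderiv ℝ (fderiv ℝ (slice φ i (c • x))) (c • x i) := by
    have hd : DifferentiableAt ℝ (fun y => fderiv ℝ (slice φ i (c • x)) (c • y)) (x i) :=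
      (((hφ.slice i (c • x)).fderiv_right (m := 1) le_rfl).differentiable one_ne_zero _).comp _
        (differentiableAt_id.const_smul c)
    rw [fderiv_fun_const_smul hd, fderiv_comp_smul (𝕜 := ℝ) (f := fderiv ℝ (slice φ i (c • x)))]
  rw [h2]
  simp
  ring

end Slices

/-! ### Integrals against a flow of regular positive densities. -/

section RegularDensity

variable {G : Type*} [NormedAddCommGroup G]

/-- Compactness of a closed time interval times `K`. This supplies the dominating constants for
limits and derivatives under the integral. -/
lemma ContinuousOn.exists_local_bound {T : ℝ} {F : ℝ × G → ℝ}
    (hF : ContinuousOn F (Ioo 0 T ×ˢ univ)) {K : Set G} (hK : IsCompact K) {t : ℝ}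
    (ht : t ∈ Ioo 0 T) :
    ∃ M, ∀ᶠ r in 𝓝 t, r ∈ Ioo 0 T ∧ ∀ x ∈ K, |F (r, x)| ≤ M := by
  obtain ⟨ε, hε, hsub⟩ := Metric.nhds_basis_closedBall.mem_iff.1 (isOpen_Ioo.mem_nhds ht)
  have hcomp : IsCompact (Metric.closedBall t ε ×ˢ K) := (isCompact_closedBall t ε).prod hK
  obtain ⟨M, hM⟩ := hcomp.exists_bound_of_continuousOn
    (hF.mono (prod_mono hsub (subset_univ _)))
  refine ⟨M, ?_⟩
  filter_upwards [Metric.closedBall_mem_nhds t hε] with r hr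
  exact ⟨hsub hr, fun x hx => hM (r, x) ⟨hr, hx⟩⟩

variable [NormedSpace ℝ G] [MeasureSpace G] {T : ℝ} {μ : ℝ → Measure G} {ρ : ℝ → G → ℝ}

namespace IsRegularDensity

lemma continuous (h : IsRegularDensity T μ ρ) {s : ℝ} (hs : s ∈ Ioo 0 T) : Continuous (ρ s) :=
  (h.contDiff s hs).continuous

lemma hasDerivAt (h : IsRegularDensity T μ ρ) {s : ℝ} (hs : s ∈ Ioo 0 T) (x : G) :
    HasDerivAt (fun r => ρ r x) (deriv (fun r => ρ r x) s) s :=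
  (h.differentiableAt s hs x).hasDerivAt

lemma continuous_deriv (h : IsRegularDensity T μ ρ) {s : ℝ} (hs : s ∈ Ioo 0 T) :
    Continuous fun x => deriv (fun r => ρ r x) s :=
  h.continuousOn_deriv.comp_continuous (f := fun x : G => (s, x)) (by fun_prop)
    fun x => ⟨hs, mem_univ x⟩

variable [BorelSpace G]

lemma integrable_iff (h : IsRegularDensity T μ ρ) {s : ℝ} (hs : s ∈ Ioo 0 T) {φ : G → ℝ} :
    Integrable φ (μ s) ↔ Integrable fun x => ρ s x * φ x := by
  rw [h.eq_withDensity s hs, integrable_withDensity_iff_integrable_smul'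
    (h.continuous hs).measurable.ennreal_ofReal (ae_of_all _ fun _ => ENNReal.ofReal_lt_top)]
  simp only [ENNReal.toReal_ofReal (h.pos s hs _).le, smul_eq_mul]

lemma integral_eq (h : IsRegularDensity T μ ρ) {s : ℝ} (hs : s ∈ Ioo 0 T) (φ : G → ℝ) :
    ∫ x, φ x ∂(μ s) = ∫ x, ρ s x * φ x := by
  rw [h.eq_withDensity s hs, integral_withDensity_eq_integral_toReal_smul
    (h.continuous hs).measurable.ennreal_ofReal (ae_of_all _ fun _ => ENNReal.ofReal_lt_top)]
  simp only [ENNReal.toReal_ofReal (h.pos s hs _).le, smul_eq_mul]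

/-- A function with compact support which is integrable against `ρ s` is integrable. -/
lemma integrable_volume (h : IsRegularDensity T μ ρ) {s : ℝ} (hs : s ∈ Ioo 0 T) {q : G → ℝ}
    (hq : Integrable q (μ s)) (hqK : HasCompactSupport q) : Integrable q := by
  have hpos : ∀ x, 0 < ρ s x := h.pos s hs
  have hcont : Continuous fun x => (ρ s x)⁻¹ := (h.continuous hs).inv₀ fun x => (hpos x).ne'
  -- Positivity of the density enters here: its inverse is continuous, hence bounded on the support
  -- of `q`.
  obtain ⟨M, hM⟩ := IsCompact.exists_bound_of_continuousOn (s := tsupport q) hqK hcont.continuousOn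
  have hi := (h.integrable_iff hs).1 hq
  have heq : q = fun x => (ρ s x)⁻¹ * (ρ s x * q x) := by
    ext x
    rw [inv_mul_cancel_left₀ (hpos x).ne']
  refine (hi.norm.const_mul M).mono' ?_ (ae_of_all _ fun x => ?_)
  · rw [heq]
    exact hcont.aestronglyMeasurable.mul hi.1
  · by_cases hx : x ∈ tsupport q
    · nth_rw 1 [heq]
      rw [norm_mul]
      gcongr
      exact hM x hx
    · simp [image_eq_zero_of_notMem_tsupport hx]

lemma integrable_mul (h : IsRegularDensity T μ ρ) {s : ℝ} (hs : s ∈ Ioo 0 T) {q : G → ℝ}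
    (hq : Integrable q) (hqK : HasCompactSupport q) : Integrable fun x => ρ s x * q x := by
  obtain ⟨M, hM⟩ := IsCompact.exists_bound_of_continuousOn (s := tsupport q) hqK
    (h.continuous hs).continuousOn
  refine (hq.norm.const_mul M).mono' ((h.continuous hs).aestronglyMeasurable.mul hq.1)
    (ae_of_all _ fun x => ?_)
  by_cases hx : x ∈ tsupport q
  · rw [norm_mul]
    gcongr
    exact hM x hx
  · simp [image_eq_zero_of_notMem_tsupport hx]

/-- Only the density moves with time, so `q` need not be continuous. This matters because `q` will
contain the merely measurable drift. -/
lemma continuousAt_integral (h : IsRegularDensity T μ ρ) {t : ℝ} (ht : t ∈ Ioo 0 T)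
    {q : G → ℝ} (hq : Integrable q) (hqK : HasCompactSupport q) :
    ContinuousAt (fun s => ∫ x, q x ∂(μ s)) t := by
  have hev : (fun s => ∫ x, q x ∂(μ s)) =ᶠ[𝓝 t] fun s => ∫ x, ρ s x * q x := by
    filter_upwards [isOpen_Ioo.mem_nhds ht] with s hs using h.integral_eq hs q
  refine ContinuousAt.congr ?_ hev.symm
  obtain ⟨M, hM⟩ := h.continuousOn.exists_local_bound (K := tsupport q) hqK ht
  refine continuousAt_of_dominated (bound := fun x => M * ‖q x‖) ?_ ?_ (hq.norm.const_mul M)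
    (ae_of_all _ fun x => ?_)
  · filter_upwards [isOpen_Ioo.mem_nhds ht] with s hs
    exact (h.continuous hs).aestronglyMeasurable.mul hq.1
  · filter_upwards [hM] with s hs
    refine ae_of_all _ fun x => ?_
    by_cases hx : x ∈ tsupport q
    · rw [norm_mul]
      gcongr
      exact hs.2 x hx
    · simp [image_eq_zero_of_notMem_tsupport hx]
  · exact (h.differentiableAt t ht x).continuousAt.mul continuousAt_const

lemma hasDerivAt_integral [IsFiniteMeasureOnCompacts (volume : Measure G)]
    (h : IsRegularDensity T μ ρ) {t : ℝ} (ht : t ∈ Ioo 0 T) {φ : G → ℝ} (hφ : Continuous φ)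
    (hφK : HasCompactSupport φ) :
    HasDerivAt (fun s => ∫ x, φ x ∂(μ s)) (∫ x, deriv (fun r => ρ r x) t * φ x) t := by
  have hev : (fun s => ∫ x, φ x ∂(μ s)) =ᶠ[𝓝 t] fun s => ∫ x, ρ s x * φ x := by
    filter_upwards [isOpen_Ioo.mem_nhds ht] with s hs using h.integral_eq hs φ
  refine HasDerivAt.congr_of_eventuallyEq ?_ hev
  have hφi : Integrable φ := hφ.integrable_of_hasCompactSupport hφK
  obtain ⟨M, hM⟩ := h.continuousOn_deriv.exists_local_bound (K := tsupport φ) hφK ht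
  refine (hasDerivAt_integral_of_dominated_loc_of_deriv_le (bound := fun x => M * ‖φ x‖)
    (F' := fun s x => deriv (fun r => ρ r x) s * φ x) hM ?_ (h.integrable_mul ht hφi hφK)
    ((h.continuous_deriv ht).mul hφ).aestronglyMeasurable (ae_of_all _ fun x s hs => ?_)
    (hφi.norm.const_mul M) (ae_of_all _ fun x s hs => ?_)).2
  · filter_upwards [isOpen_Ioo.mem_nhds ht] with s hs
    exact ((h.continuous hs).mul hφ).aestronglyMeasurable
  · by_cases hx : x ∈ tsupport φ
    · rw [norm_mul]
      gcongr
      exact hs.2 x hx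
    · simp [image_eq_zero_of_notMem_tsupport hx]
  · exact (h.hasDerivAt hs.1 x).mul_const _

end IsRegularDensity

end RegularDensity

/-! ### Measurability and support of the particle generator. -/

section Generators

variable {N d : ℕ}

lemma continuous_laplacian {φ : Space d → ℝ} (hφ : ContDiff ℝ 2 φ) :
    Continuous (Laplacian.laplacian φ) := by
  rw [show Laplacian.laplacian φ = _ from funext fun x => laplacian_eq_sum_fderiv_fderiv φ x]
  refine continuous_finsetSum _ fun k _ => ?_
  exact (((hφ.fderiv_right (m := 1) le_rfl).continuous_fderiv one_ne_zero).clm_apply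
    continuous_const).clm_apply continuous_const

lemma measurable_empiricalMeasure [NeZero N] :
    Measurable (empiricalMeasure : Config N d → ProbabilityMeasure (Space d)) := by
  refine Measurable.subtype_mk ?_
  refine Measure.measurable_of_measurable_coe _ fun s hs => ?_
  simp only [Measure.smul_apply, Measure.finsetSum_apply, Measure.dirac_apply' _ hs, smul_eq_mul]
  refine Measurable.const_mul (Finset.measurable_sum _ fun i _ => ?_) _
  exact (measurable_const.indicator hs).comp (measurable_pi_apply i)

lemma measurable_drift [NeZero N] {b : Space d → ProbabilityMeasure (Space d) → Space d}
    (hb : Measurable (Function.uncurry b)) (i : Fin N) :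
    Measurable fun x : Config N d => b (x i) (empiricalMeasure x) :=
  hb.comp ((measurable_pi_apply i).prodMk measurable_empiricalMeasure)

lemma particleGenerator_eq [NeZero N] (b : Space d → ProbabilityMeasure (Space d) → Space d)
    (φ : Config N d → ℝ) (x : Config N d) :
    particleGenerator b φ x = ∑ i, (⟪b (x i) (empiricalMeasure x), particleGradient φ i x⟫_ℝ
      + 1 / 2 * particleLaplacian φ i x) := rfl

lemma measurable_particleGenerator [NeZero N]
    {b : Space d → ProbabilityMeasure (Space d) → Space d}
    (hb : Measurable (Function.uncurry b)) {φ : Config N d → ℝ} (hφ : ContDiff ℝ 2 φ) :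
    Measurable (particleGenerator b φ) := by
  refine Finset.measurable_sum _ fun i _ => ?_
  exact ((measurable_drift hb i).inner
    (continuous_particleGradient (hφ.of_le one_le_two) i).measurable).add
    ((continuous_particleLaplacian hφ i).measurable.const_mul _)

lemma hasCompactSupport_particleGenerator [NeZero N]
    (b : Space d → ProbabilityMeasure (Space d) → Space d) {φ : Config N d → ℝ}
    (hφ : HasCompactSupport φ) : HasCompactSupport (particleGenerator b φ) := by
  refine HasCompactSupport.intro hφ fun x hx => ?_
  simp [particleGenerator_eq, particleGradient_eq_zero hx, particleLaplacian_eq_zero hx]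

end Generators

/-! ### From the martingale problem to the Fokker–Planck equation at a fixed time. -/

section Particles

variable {N d : ℕ} [NeZero N] {Ω : Type*} {mΩ : MeasurableSpace Ω} {P : Measure Ω}
  {b : Space d → ProbabilityMeasure (Space d) → Space d} {T : ℝ}
  {ℱ : Filtration (Icc (0 : ℝ) T) mΩ} {X : ℝ → Ω → Config N d}

namespace IsParticleSystem

lemma measurable (hX : IsParticleSystem b T ℱ P X) {s : ℝ} (hs : s ∈ Icc 0 T) :
    Measurable (X s) :=
  (hX.adapted ⟨s, hs⟩).mono (ℱ.le _) le_rfl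

/-- The compensated process vanishes at time `0`, so its mean vanishes at time `s`; Fubini exchanges
expectation and time integral. -/
lemma integral_sub_eq [IsProbabilityMeasure P] (hX : IsParticleSystem b T ℱ P X) {φ : Config N d → ℝ}
    (hφ : ContDiff ℝ 2 φ) (hφK : HasCompactSupport φ) {s : ℝ} (hs : s ∈ Icc 0 T) :
    ∫ ω, φ (X s ω) ∂P - ∫ ω, φ (X 0 ω) ∂P =
      ∫ r in (0 : ℝ)..s, ∫ ω, particleGenerator b φ (X r ω) ∂P := by
  have h0 : (0 : ℝ) ∈ Icc 0 T := ⟨le_rfl, hs.1.trans hs.2⟩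
  have hM := hX.martingale φ hφ hφK
  obtain ⟨C, hC⟩ := hφK.exists_bound_of_continuous hφ.continuous
  have hint : ∀ r ∈ Icc 0 T, Integrable (fun ω => φ (X r ω)) P := fun r hr =>
    Integrable.of_bound (hφ.continuous.measurable.comp (hX.measurable hr)).aestronglyMeasurable C
      (ae_of_all _ fun ω => hC _)
  have hmart := hM.setIntegral_eq (i := ⟨0, h0⟩) (j := ⟨s, hs⟩) hs.1 MeasurableSet.univ
  simp only [Measure.restrict_univ, sub_self, intervalIntegral.integral_same, integral_zero]
    at hmart
  have hsub : Integrable (fun ω => φ (X s ω) - φ (X 0 ω)) P := (hint s hs).sub (hint 0 h0)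
  have hI : Integrable (fun ω => ∫ r in (0 : ℝ)..s, particleGenerator b φ (X r ω)) P := by
    refine (hsub.sub (hM.integrable ⟨s, hs⟩)).congr (ae_of_all _ fun ω => ?_)
    simp
  rw [integral_sub hsub hI, integral_sub (hint s hs) (hint 0 h0)] at hmart
  rw [sub_eq_zero.1 hmart.symm]
  simp only [intervalIntegral.integral_of_le hs.1]
  symm
  refine integral_integral_swap (μ := volume.restrict (Ioc 0 s)) (ν := P)
    (f := fun r ω => particleGenerator b φ (X r ω)) ?_
  have := (hX.integrable φ hφ hφK).restrict (s := Ioc 0 s ×ˢ univ)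
  rwa [← Measure.prod_restrict, Measure.restrict_univ, Measure.restrict_restrict measurableSet_Ioc,
    inter_eq_self_of_subset_left (Ioc_subset_Icc_self.trans (Icc_subset_Icc_right hs.2))] at this

/-- The weak form, at time `t`, of the Fokker–Planck equation of the particle system. -/
lemma integral_deriv_density [IsProbabilityMeasure P] (hX : IsParticleSystem b T ℱ P X)
    (hb : Measurable (Function.uncurry b)) {p : ℝ → Config N d → ℝ}
    (hp : IsRegularDensity T (fun s => P.map (X s)) p) {t : ℝ} (ht : t ∈ Ioo 0 T)
    {φ : Config N d → ℝ} (hφ : ContDiff ℝ 2 φ) (hφK : HasCompactSupport φ) :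
    Integrable (fun x => p t x * particleGenerator b φ x) ∧
      ∫ x, deriv (fun r => p r x) t * φ x = ∫ x, p t x * particleGenerator b φ x := by
  have hmeas : ∀ {r}, r ∈ Ioo 0 T → AEMeasurable (X r) P := fun hr =>
    (hX.measurable (Ioo_subset_Icc_self hr)).aemeasurable
  have hT : 0 < T := ht.1.trans ht.2
  set q : Config N d → ℝ := particleGenerator b φ with hq
  have hqm : Measurable q := measurable_particleGenerator hb hφ
  have hqK : HasCompactSupport q := hasCompactSupport_particleGenerator b hφK
  have hqX := hX.integrable φ hφ hφK
  -- Integrability on `[0, T] × Ω` gives only almost every time. One good time suffices: there the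
  -- positive density makes `q` Lebesgue integrable, and this passes to every time in `(0, T)`.
  obtain ⟨r₀, hr₀, hr₀T⟩ : ∃ r, Integrable (fun ω => q (X r ω)) P ∧ r ∈ Ioo 0 T := by
    have h1 : ∀ᵐ r ∂volume.restrict (Ioo 0 T), Integrable (fun ω => q (X r ω)) P :=
      ae_mono (Measure.restrict_mono Ioo_subset_Icc_self le_rfl) hqX.prod_right_ae
    have : NeBot (ae (volume.restrict (Ioo 0 T))) := by
      rw [ae_neBot, Ne, Measure.restrict_eq_zero]
      simp [hT]
    exact (h1.and (ae_restrict_mem measurableSet_Ioo)).exists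
  have hqv : Integrable q := hp.integrable_volume hr₀T
    ((integrable_map_measure hqm.aestronglyMeasurable (hmeas hr₀T)).2 hr₀) hqK
  refine ⟨hp.integrable_mul ht hqv hqK, ?_⟩
  have hcont : ∀ r ∈ Ioo 0 T, ContinuousAt (fun s => ∫ ω, q (X s ω) ∂P) r := fun r hr => by
    refine (hp.continuousAt_integral hr hqv hqK).congr ?_
    filter_upwards [isOpen_Ioo.mem_nhds hr] with s hs
    exact integral_map (hmeas hs) hqm.aestronglyMeasurable
  -- Continuity in time of the mean of the generator turns the integrated equation into a derivative
  -- at the given `t`, not just at almost every time.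
  have hFTC := intervalIntegral.integral_hasDerivAt_right (f := fun s => ∫ ω, q (X s ω) ∂P)
    (a := 0) (b := t) ?_ (ContinuousOn.stronglyMeasurableAtFilter isOpen_Ioo
      (fun r hr => (hcont r hr).continuousWithinAt) t ht) (hcont t ht)
  · have h2 := hp.hasDerivAt_integral ht hφ.continuous hφK
    have hev : (fun s => ∫ x, φ x ∂(P.map (X s))) =ᶠ[𝓝 t] fun s =>
        (∫ r in (0 : ℝ)..s, ∫ ω, q (X r ω) ∂P) + ∫ ω, φ (X 0 ω) ∂P := by
      filter_upwards [isOpen_Ioo.mem_nhds ht] with s hs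
      rw [integral_map (hmeas hs) hφ.continuous.aestronglyMeasurable,
        ← hX.integral_sub_eq hφ hφK (Ioo_subset_Icc_self hs), sub_add_cancel]
    rw [h2.unique ((hFTC.add_const _).congr_of_eventuallyEq hev), ← hp.integral_eq ht q,
      integral_map (hmeas ht) hqm.aestronglyMeasurable]
  · rw [intervalIntegrable_iff_integrableOn_Ioc_of_le ht.1.le]
    have hG : IntegrableOn (fun s => ∫ ω, q (X s ω) ∂P) (Icc 0 T) := hqX.integral_prod_left
    exact hG.mono_set fun r hr => ⟨hr.1.le, hr.2.trans ht.2.le⟩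

end IsParticleSystem

end Particles

/-! ### The tensorized density. -/

section Tensor

variable {N d : ℕ}

/-- The tensorized density `∏ᵢ u(s, xⁱ)`. -/
def tensorDensity (N : ℕ) {d : ℕ} (u : ℝ → Space d → ℝ) (s : ℝ) (x : Config N d) : ℝ :=
  ∏ i : Fin N, u s (x i)

variable {T : ℝ} {f : ℝ → ProbabilityMeasure (Space d)} {u : ℝ → Space d → ℝ}

/-- On a box, the tensor density times the indicator is a product of one-variable functions, so its
integral factors, and boxes determine the product measure. -/
lemma tensorPower_eq_withDensity
    (hu : IsRegularDensity T (fun s => (f s : Measure (Space d))) u) {s : ℝ} (hs : s ∈ Ioo 0 T) :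
    tensorPower N (f s) =
      volume.withDensity fun x => ENNReal.ofReal (tensorDensity N u s x) := by
  have hint : Integrable (u s) := by
    have := (hu.integrable_iff hs (φ := fun _ => 1)).1 (integrable_const 1)
    simpa using this
  have hpos : ∀ x, 0 ≤ u s x := fun x => (hu.pos s hs x).le
  refine Measure.pi_eq fun A hA => ?_
  have hAm : MeasurableSet (univ.pi A) := MeasurableSet.univ_pi hA
  have hind : ∀ x : Config N d, (univ.pi A).indicator (tensorDensity N u s) x =
      ∏ i, (A i).indicator (u s) (x i) := by
    intro x
    by_cases hx : x ∈ univ.pi A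
    · rw [indicator_of_mem hx]
      exact Finset.prod_congr rfl fun i _ => (indicator_of_mem (hx i (mem_univ i)) _).symm
    · rw [indicator_of_notMem hx]
      simp only [Set.mem_pi, mem_univ, true_imp_iff, not_forall] at hx
      obtain ⟨i, hi⟩ := hx
      exact (Finset.prod_eq_zero (Finset.mem_univ i) (indicator_of_notMem hi _)).symm
  have hprod : Integrable fun x : Config N d => ∏ i, (A i).indicator (u s) (x i) :=
    Integrable.fintype_prod fun i => hint.indicator (hA i)
  have hnn : ∀ x : Config N d, 0 ≤ ∏ i, (A i).indicator (u s) (x i) := fun x =>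
    Finset.prod_nonneg fun i _ => indicator_nonneg (fun y _ => hpos y) _
  have h1 : ∀ i, (f s : Measure (Space d)) (A i) =
      ENNReal.ofReal (∫ y, (A i).indicator (u s) y) := fun i => by
    have h := hu.eq_withDensity s hs
    rw [h, withDensity_apply _ (hA i), integral_indicator (hA i),
      ofReal_integral_eq_lintegral_ofReal hint.integrableOn (ae_of_all _ hpos)]
  rw [withDensity_apply _ hAm, ← lintegral_indicator hAm, Finset.prod_congr rfl fun i _ => h1 i,
    ← ENNReal.ofReal_prod_of_nonneg fun i _ =>
      integral_nonneg fun y => indicator_nonneg (fun y _ => hpos y) _,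
    ← integral_fintype_prod_volume_eq_prod fun i => (A i).indicator (u s),
    ofReal_integral_eq_lintegral_ofReal hprod (ae_of_all _ hnn)]
  refine lintegral_congr fun x => ?_
  rw [← hind]
  by_cases hx : x ∈ univ.pi A <;> simp [hx]

lemma tensorDensity_pos (hu : IsRegularDensity T (fun s => (f s : Measure (Space d))) u) {s : ℝ}
    (hs : s ∈ Ioo 0 T) (x : Config N d) : 0 < tensorDensity N u s x :=
  Finset.prod_pos fun i _ => hu.pos s hs (x i)

lemma contDiff_tensorDensity (hu : IsRegularDensity T (fun s => (f s : Measure (Space d))) u)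
    {s : ℝ} (hs : s ∈ Ioo 0 T) : ContDiff ℝ 2 (tensorDensity N u s) :=
  contDiff_prod fun i _ => (hu.contDiff s hs).comp (contDiff_apply ℝ (Space d) i)

lemma hasDerivAt_tensorDensity (hu : IsRegularDensity T (fun s => (f s : Measure (Space d))) u)
    {s : ℝ} (hs : s ∈ Ioo 0 T) (x : Config N d) :
    HasDerivAt (fun r => tensorDensity N u r x)
      (∑ i, (∏ j ∈ Finset.univ.erase i, u s (x j)) * deriv (fun r => u r (x i)) s) s :=
  HasDerivAt.fun_finsetProd fun i _ => hu.hasDerivAt hs (x i)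

lemma continuous_deriv_tensorDensity
    (hu : IsRegularDensity T (fun s => (f s : Measure (Space d))) u) {s : ℝ} (hs : s ∈ Ioo 0 T) :
    Continuous fun x : Config N d => deriv (fun r => tensorDensity N u r x) s := by
  simp only [(hasDerivAt_tensorDensity hu hs _).deriv]
  have h1 := hu.continuous hs
  have h2 := hu.continuous_deriv hs
  exact continuous_finsetSum _ fun i _ => (continuous_finsetProd _ fun j _ =>
    h1.comp (continuous_apply j)).mul (h2.comp (continuous_apply i))

lemma integrable_tensorPower_iff
    (hu : IsRegularDensity T (fun s => (f s : Measure (Space d))) u) {s : ℝ} (hs : s ∈ Ioo 0 T)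
    {φ : Config N d → ℝ} :
    Integrable φ (tensorPower N (f s)) ↔ Integrable fun x => tensorDensity N u s x * φ x := by
  rw [tensorPower_eq_withDensity hu hs, integrable_withDensity_iff_integrable_smul'
    (contDiff_tensorDensity hu hs).continuous.measurable.ennreal_ofReal
    (ae_of_all _ fun _ => ENNReal.ofReal_lt_top)]
  simp only [ENNReal.toReal_ofReal (tensorDensity_pos hu hs _).le, smul_eq_mul]

/-- An integrable function on the configurations whose integral in the `i`-th variable vanishes has
integral zero. -/
lemma integral_eq_zero_of_integral_update_eq_zero {F : Config N d → ℝ} (hF : Integrable F)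
    (i : Fin N) (h : ∀ x : Config N d, ∫ y, F (Function.update x i y) = 0) : ∫ x, F x = 0 := by
  obtain _ | n := N
  · exact i.elim0
  have hmp := (volume_preserving_piFinSuccAbove (fun _ : Fin (n + 1) => Space d) i).symm
  have hF' := (hmp.integrable_comp_emb (MeasurableEquiv.measurableEmbedding _)).2 hF
  rw [← hmp.integral_comp' F]
  change ∫ z, (F ∘ (MeasurableEquiv.piFinSuccAbove (fun _ => Space d) i).symm) z = 0
  rw [Measure.volume_eq_prod,
    integral_prod_symm (F ∘ (MeasurableEquiv.piFinSuccAbove (fun _ => Space d) i).symm) hF']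
  refine integral_eq_zero_of_ae (ae_of_all _ fun z => ?_)
  -- The value `0` in slot `i` is arbitrary, since the update overwrites it.
  have := h (i.insertNth 0 z)
  simp only [Fin.update_insertNth] at this
  exact this

end Tensor

/-! ### The limit equation and its tensorization. -/

section McKeanVlasov

variable {N d : ℕ} {b : Space d → ProbabilityMeasure (Space d) → Space d} {T : ℝ}
  {f : ℝ → ProbabilityMeasure (Space d)} {u : ℝ → Space d → ℝ}

namespace IsMcKeanVlasovSolution

/-- The drift of the limit equation is locally integrable. -/
lemma integrable_indicator_drift (hf : IsMcKeanVlasovSolution b T f)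
    (hb : Measurable (Function.uncurry b)) {t : ℝ} (ht : t ∈ Ioo 0 T) {R : ℝ} (hR : 0 < R) :
    Integrable ((Metric.closedBall (0 : Space d) R).indicator fun y => b y (f t))
      (f t : Measure (Space d)) := by
  have hbm : Measurable fun y => b y (f t) := hb.comp (measurable_id.prodMk measurable_const)
  -- The inner radius `R + 1` makes `c · ⟨e, ·⟩` equal to `⟨e, ·⟩` in a neighbourhood of each point
  -- of the ball of radius `R`, so its gradient there is `e` and testing the equation isolates one
  -- coordinate of the drift.
  let c : ContDiffBump (0 : Space d) := ⟨R + 1, R + 2, by linarith, by linarith⟩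
  have hcoord : ∀ k, Integrable ((Metric.closedBall (0 : Space d) R).indicator
      fun y => ⟪b y (f t), EuclideanSpace.basisFun (Fin d) ℝ k⟫_ℝ) (f t : Measure (Space d)) := by
    intro k
    set e := EuclideanSpace.basisFun (Fin d) ℝ k
    set φ : Space d → ℝ := fun y => c y * ⟪e, y⟫_ℝ
    have hφ : ContDiff ℝ 2 φ := c.contDiff.mul (innerSL ℝ e).contDiff
    have hφK : HasCompactSupport φ := c.hasCompactSupport.mul_right
    have hΔ : Integrable (Laplacian.laplacian φ) (f t : Measure (Space d)) := by
      have hK : HasCompactSupport (Laplacian.laplacian φ) := by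
        refine HasCompactSupport.intro (K := tsupport φ) hφK fun x hx => ?_
        rw [(InnerProductSpace.laplacian_congr_nhds
          (notMem_tsupport_iff_eventuallyEq.1 hx)).eq_of_nhds]
        exact congrFun (InnerProductSpace.laplacian_const (c := (0 : ℝ))) x
      exact (continuous_laplacian hφ).integrable_of_hasCompactSupport hK
    have hI := ((hf.integrable t ht φ hφ hφK).sub (hΔ.const_mul (1 / 2))).indicator
      (Metric.isClosed_closedBall (x := (0 : Space d)) (ε := R)).measurableSet
    refine hI.congr (ae_of_all _ fun y => ?_)
    by_cases hy : y ∈ Metric.closedBall (0 : Space d) R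
    · have hgrad : gradient φ y = e := by
        have hev : φ =ᶠ[𝓝 y] fun y => ⟪e, y⟫_ℝ := by
          have hy' : y ∈ Metric.ball (0 : Space d) (R + 1) :=
            Metric.closedBall_subset_ball (by linarith) hy
          filter_upwards [Metric.isOpen_ball.mem_nhds hy'] with z hz
          simp only [φ]
          rw [c.one_of_mem_closedBall (Metric.ball_subset_closedBall hz), one_mul]
        rw [hev.gradient_eq]
        refine HasGradientAt.gradient ?_
        rw [hasGradientAt_iff_hasFDerivAt]
        exact (innerSL ℝ e).hasFDerivAt
      simp [hy, generator, hgrad]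
    · simp [hy]
  refine (integrable_finsetSum Finset.univ fun k _ => (hcoord k).norm).mono'
    ((hbm.indicator Metric.isClosed_closedBall.measurableSet).aestronglyMeasurable)
    (ae_of_all _ fun y => ?_)
  by_cases hy : y ∈ Metric.closedBall (0 : Space d) R
  · simp only [indicator_of_mem hy]
    rw [← (EuclideanSpace.basisFun (Fin d) ℝ).sum_repr' (b y (f t))]
    refine (norm_sum_le _ _).trans (Finset.sum_le_sum fun k _ => ?_)
    rw [OrthonormalBasis.sum_repr', norm_smul, (EuclideanSpace.basisFun (Fin d) ℝ).norm_eq_one,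
      mul_one, real_inner_comm]
  · simp [hy]

/-- The weak form of the Fokker–Planck equation in terms of the density. -/
lemma integral_deriv_density (hf : IsMcKeanVlasovSolution b T f)
    (hu : IsRegularDensity T (fun s => (f s : Measure (Space d))) u) {t : ℝ} (ht : t ∈ Ioo 0 T)
    {φ : Space d → ℝ} (hφ : ContDiff ℝ 2 φ) (hφK : HasCompactSupport φ) :
    ∫ y, deriv (fun r => u r y) t * φ y = ∫ y, u t y * generator b (f t) φ y := by
  rw [(hu.hasDerivAt_integral ht hφ.continuous hφK).unique (hf.hasDerivAt t ht φ hφ hφK)]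
  exact hu.integral_eq ht _

/-- The weak formulation gives integrability slice by slice, which is not joint integrability.
Jointly, the gradient is bounded, and on the support of `φ` the drift agrees with its truncation to
a ball, which is integrable. -/
lemma integrable_generator_slice (hf : IsMcKeanVlasovSolution b T f)
    (hb : Measurable (Function.uncurry b))
    (hu : IsRegularDensity T (fun s => (f s : Measure (Space d))) u) {t : ℝ} (ht : t ∈ Ioo 0 T)
    {φ : Config N d → ℝ} (hφ : ContDiff ℝ 2 φ) (hφK : HasCompactSupport φ) (i : Fin N) :
    Integrable fun x => tensorDensity N u t x * generator b (f t) (slice φ i x) (x i) := by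
  rw [← integrable_tensorPower_iff hu ht]
  have hbm : Measurable fun y => b y (f t) := hb.comp (measurable_id.prodMk measurable_const)
  have hg := continuous_particleGradient (hφ.of_le one_le_two) i
  have hgK := hasCompactSupport_particleGradient hφK i
  have : IsProbabilityMeasure (tensorPower N (f t)) := by unfold tensorPower; infer_instance
  obtain ⟨C, hC⟩ := hgK.exists_bound_of_continuous hg
  obtain ⟨R, hR, hKR⟩ : ∃ R, 0 < R ∧ tsupport φ ⊆ Metric.closedBall 0 R :=
    (IsCompact.isBounded hφK).subset_closedBall_lt 0 0
  refine Integrable.add ?_ (((continuous_particleLaplacian hφ i).integrable_of_hasCompactSupport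
    (hasCompactSupport_particleLaplacian hφK i)).const_mul (1 / 2))
  have hI : Integrable (fun x : Config N d =>
      (Metric.closedBall (0 : Space d) R).indicator (fun y => b y (f t)) (x i))
      (tensorPower N (f t)) :=
    integrable_comp_eval (μ := fun _ : Fin N => (f t : Measure (Space d))) (i := i)
      (hf.integrable_indicator_drift hb ht hR)
  refine (hI.norm.mul_const C).mono'
    ((hbm.comp (measurable_pi_apply i)).inner hg.measurable).aestronglyMeasurable
    (ae_of_all _ fun x => ?_)
  by_cases hx : x ∈ tsupport φ
  · have hxi : x i ∈ Metric.closedBall (0 : Space d) R := by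
      have := hKR hx
      rw [mem_closedBall_zero_iff] at this ⊢
      exact (norm_le_pi_norm x i).trans this
    rw [indicator_of_mem hxi]
    exact (norm_inner_le_norm _ _).trans (mul_le_mul_of_nonneg_left (hC x) (norm_nonneg _))
  · change ‖⟪b (x i) (f t), particleGradient φ i x⟫_ℝ‖ ≤ _
    rw [particleGradient_eq_zero hx, inner_zero_right, norm_zero]
    exact mul_nonneg (norm_nonneg _) ((norm_nonneg _).trans (hC x))

/-- The weak form, at time `t`, of the Fokker–Planck equation of the tensorized flow. -/
lemma integral_deriv_tensorDensity (hf : IsMcKeanVlasovSolution b T f)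
    (hb : Measurable (Function.uncurry b))
    (hu : IsRegularDensity T (fun s => (f s : Measure (Space d))) u) {t : ℝ} (ht : t ∈ Ioo 0 T)
    {φ : Config N d → ℝ} (hφ : ContDiff ℝ 2 φ) (hφK : HasCompactSupport φ) :
    ∫ x, deriv (fun r => tensorDensity N u r x) t * φ x =
      ∫ x, ∑ i, tensorDensity N u t x * generator b (f t) (slice φ i x) (x i) := by
  have hA : ∀ i : Fin N, Integrable fun x : Config N d =>
      (∏ j ∈ Finset.univ.erase i, u t (x j)) * deriv (fun r => u r (x i)) t * φ x := by
    intro i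
    refine Continuous.integrable_of_hasCompactSupport ?_ hφK.mul_left
    have h1 := hu.continuous ht
    have h2 := hu.continuous_deriv ht
    exact ((continuous_finsetProd _ fun j _ => h1.comp (continuous_apply j)).mul
      (h2.comp (continuous_apply i))).mul hφ.continuous
  have hB := fun i => hf.integrable_generator_slice hb hu ht hφ hφK i
  simp only [(hasDerivAt_tensorDensity hu ht _).deriv, Finset.sum_mul]
  rw [integral_finsetSum _ fun i _ => hA i, integral_finsetSum _ fun i _ => hB i]
  refine Finset.sum_congr rfl fun i _ => ?_
  rw [← sub_eq_zero, ← integral_sub (hA i) (hB i)]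
  -- With the other particles frozen, the factors `u t (x j)`, `j ≠ i`, are constants, and the slice
  -- of `φ` is an admissible test function for the one-particle equation.
  refine integral_eq_zero_of_integral_update_eq_zero ((hA i).sub (hB i)) i fun x => ?_
  have hprod : ∀ y, ∏ j ∈ Finset.univ.erase i, u t (Function.update x i y j) =
      ∏ j ∈ Finset.univ.erase i, u t (x j) := fun y =>
    Finset.prod_congr rfl fun j hj => by rw [Function.update_of_ne (Finset.ne_of_mem_erase hj)]
  have hten : ∀ y, tensorDensity N u t (Function.update x i y) =
      (∏ j ∈ Finset.univ.erase i, u t (x j)) * u t y := fun y => by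
    rw [tensorDensity, ← Finset.prod_erase_mul _ _ (Finset.mem_univ i), hprod,
      Function.update_self]
  have hs : ContDiff ℝ 2 (slice φ i x) := hφ.slice i x
  have hsK : HasCompactSupport (slice φ i x) := hφK.slice i x
  simp only [hprod, hten, Function.update_self, slice_update, mul_assoc, ← mul_sub]
  have hA' : Integrable fun y => deriv (fun r => u r y) t * slice φ i x y :=
    ((hu.continuous_deriv ht).mul hs.continuous).integrable_of_hasCompactSupport hsK.mul_left
  have hB' : Integrable fun y => u t y * generator b (f t) (slice φ i x) y :=
    (hu.integrable_iff ht).1 (hf.integrable t ht _ hs hsK)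
  have h0 := hf.integral_deriv_density hu ht hs hsK
  rw [← sub_eq_zero, ← integral_sub hA' hB'] at h0
  rw [integral_const_mul]
  exact mul_eq_zero_of_right _ h0

end IsMcKeanVlasovSolution

end McKeanVlasov

/-! ### Relative entropy of a measure with an explicit positive density. -/

section Entropy

variable {α : Type*} {mα : MeasurableSpace α} {μ : Measure α} {h : α → ℝ}

lemma llr_withDensity_ofReal [SigmaFinite μ] (hm : Measurable h) (hpos : ∀ x, 0 < h x) :
    llr (μ.withDensity fun x => ENNReal.ofReal (h x)) μ
      =ᵐ[μ.withDensity fun x => ENNReal.ofReal (h x)] fun x => Real.log (h x) := by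
  refine (withDensity_absolutelyContinuous μ _).ae_le ?_
  filter_upwards [Measure.rnDeriv_withDensity μ hm.ennreal_ofReal] with x hx
  simp only [llr_def]
  rw [hx, ENNReal.toReal_ofReal (hpos x).le]

lemma klDiv_withDensity_ofReal_ne_top_iff [SigmaFinite μ] (hm : Measurable h)
    (hpos : ∀ x, 0 < h x) :
    klDiv (μ.withDensity fun x => ENNReal.ofReal (h x)) μ ≠ ∞ ↔
      Integrable (fun x => Real.log (h x)) (μ.withDensity fun x => ENNReal.ofReal (h x)) := by
  rw [klDiv_ne_top_iff, integrable_congr (llr_withDensity_ofReal hm hpos)]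
  exact and_iff_right (withDensity_absolutelyContinuous μ _)

/-- The mass correction in `klDiv` disappears because both measures have mass one. -/
lemma toReal_klDiv_withDensity_ofReal [IsProbabilityMeasure μ]
    [IsProbabilityMeasure (μ.withDensity fun x => ENNReal.ofReal (h x))] (hm : Measurable h)
    (hpos : ∀ x, 0 < h x) :
    (klDiv (μ.withDensity fun x => ENNReal.ofReal (h x)) μ).toReal =
      ∫ x, Real.log (h x) ∂(μ.withDensity fun x => ENNReal.ofReal (h x)) := by
  rw [toReal_klDiv_of_measure_eq (withDensity_absolutelyContinuous μ _) (by simp),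
    integral_congr_ae (llr_withDensity_ofReal hm hpos)]

end Entropy

/-! ### The density ratio, its Fisher information and its entropy in time. -/

section Ratio

variable {N d : ℕ} {T : ℝ} {ν : ℝ → Measure (Config N d)} {p : ℝ → Config N d → ℝ}
  {f : ℝ → ProbabilityMeasure (Space d)} {u : ℝ → Space d → ℝ}

lemma densityRatio_eq (p : ℝ → Config N d → ℝ) (u : ℝ → Space d → ℝ) (s : ℝ) (x : Config N d) :
    densityRatio p u s x = p s x / tensorDensity N u s x := rfl

instance (g : ProbabilityMeasure (Space d)) : IsProbabilityMeasure (tensorPower N g) := by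
  unfold tensorPower
  infer_instance

lemma densityRatio_pos (hp : IsRegularDensity T ν p)
    (hu : IsRegularDensity T (fun s => (f s : Measure (Space d))) u) {s : ℝ} (hs : s ∈ Ioo 0 T)
    (x : Config N d) : 0 < densityRatio p u s x :=
  div_pos (hp.pos s hs x) (tensorDensity_pos hu hs x)

lemma contDiff_densityRatio (hp : IsRegularDensity T ν p)
    (hu : IsRegularDensity T (fun s => (f s : Measure (Space d))) u) {s : ℝ} (hs : s ∈ Ioo 0 T) :
    ContDiff ℝ 2 (densityRatio p u s) :=
  (hp.contDiff s hs).div (contDiff_tensorDensity hu hs) fun x => (tensorDensity_pos hu hs x).ne'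

lemma contDiff_log_densityRatio (hp : IsRegularDensity T ν p)
    (hu : IsRegularDensity T (fun s => (f s : Measure (Space d))) u) {s : ℝ} (hs : s ∈ Ioo 0 T) :
    ContDiff ℝ 2 fun x => Real.log (densityRatio p u s x) :=
  (contDiff_densityRatio hp hu hs).log fun x => (densityRatio_pos hp hu hs x).ne'

lemma eq_withDensity_densityRatio (hp : IsRegularDensity T ν p)
    (hu : IsRegularDensity T (fun s => (f s : Measure (Space d))) u) {s : ℝ} (hs : s ∈ Ioo 0 T) :
    ν s = (tensorPower N (f s)).withDensity fun x => ENNReal.ofReal (densityRatio p u s x) := by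
  have h1 := (contDiff_tensorDensity (N := N) hu hs).continuous.measurable.ennreal_ofReal
  have h2 := (contDiff_densityRatio hp hu hs).continuous.measurable.ennreal_ofReal
  rw [tensorPower_eq_withDensity hu hs, ← withDensity_mul _ h1 h2, hp.eq_withDensity s hs]
  congr 1
  ext x
  rw [Pi.mul_apply, ← ENNReal.ofReal_mul (tensorDensity_pos hu hs x).le, densityRatio_eq,
    mul_div_cancel₀ _ (tensorDensity_pos hu hs x).ne']

lemma klDiv_tensorPower_ne_top_iff (hp : IsRegularDensity T ν p)
    (hu : IsRegularDensity T (fun s => (f s : Measure (Space d))) u) {s : ℝ} (hs : s ∈ Ioo 0 T) :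
    klDiv (ν s) (tensorPower N (f s)) ≠ ∞ ↔
      Integrable (fun x => p s x * Real.log (densityRatio p u s x)) := by
  rw [← hp.integrable_iff hs, eq_withDensity_densityRatio hp hu hs]
  exact klDiv_withDensity_ofReal_ne_top_iff
    (contDiff_densityRatio hp hu hs).continuous.measurable (densityRatio_pos hp hu hs)

lemma toReal_klDiv_tensorPower (hp : IsRegularDensity T ν p)
    (hu : IsRegularDensity T (fun s => (f s : Measure (Space d))) u) {s : ℝ} (hs : s ∈ Ioo 0 T)
    [IsProbabilityMeasure (ν s)] :
    (klDiv (ν s) (tensorPower N (f s))).toReal =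
      ∫ x, p s x * Real.log (densityRatio p u s x) := by
  have hν := eq_withDensity_densityRatio hp hu hs
  have : IsProbabilityMeasure
      ((tensorPower N (f s)).withDensity fun x => ENNReal.ofReal (densityRatio p u s x)) :=
    hν ▸ inferInstance
  rw [← hp.integral_eq hs, hν]
  exact toReal_klDiv_withDensity_ofReal
    (contDiff_densityRatio hp hu hs).continuous.measurable (densityRatio_pos hp hu hs)

/-- The infimum runs over a single function: two continuous versions agree almost everywhere for the
tensor power, hence for Lebesgue measure by positivity of its density, hence everywhere. -/
lemma fisherInformation_tensorPower (hp : IsRegularDensity T ν p)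
    (hu : IsRegularDensity T (fun s => (f s : Measure (Space d))) u) {s : ℝ} (hs : s ∈ Ioo 0 T) :
    fisherInformation (ν s) (tensorPower N (f s)) =
      ∫⁻ x, ENNReal.ofReal (∑ i, ‖particleGradient
        (fun y => Real.log (densityRatio p u s y)) i x‖ ^ 2) ∂(ν s) := by
  have hν := eq_withDensity_densityRatio hp hu hs
  have hc := contDiff_densityRatio hp hu hs
  refine le_antisymm (iInf₂_le_of_le (densityRatio p u s)
    ⟨hc.of_le one_le_two, fun x => (densityRatio_pos hp hu hs x).le, hν⟩ le_rfl)
    (le_iInf₂ fun h hh => ?_)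
  obtain ⟨hC1, hnn, hνh⟩ := hh
  have hae : (fun x => ENNReal.ofReal (densityRatio p u s x)) =ᵐ[tensorPower N (f s)]
      fun x => ENNReal.ofReal (h x) := by
    refine withDensity_eq_iff_of_sigmaFinite hc.continuous.measurable.ennreal_ofReal.aemeasurable
      hC1.continuous.measurable.ennreal_ofReal.aemeasurable |>.1 ?_
    rw [← hν, ← hνh]
  have hae' : densityRatio p u s =ᵐ[volume] h := by
    rw [tensorPower_eq_withDensity hu hs, Filter.EventuallyEq, ae_withDensity_iff
      (contDiff_tensorDensity hu hs).continuous.measurable.ennreal_ofReal] at hae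
    filter_upwards [hae] with x hx
    have := hx (ENNReal.ofReal_pos.2 (tensorDensity_pos hu hs x)).ne'
    rwa [ENNReal.ofReal_eq_ofReal_iff (densityRatio_pos hp hu hs x).le (hnn x)] at this
  have heq : densityRatio p u s = h := (hc.continuous.ae_eq_iff_eq volume hC1.continuous).1 hae'
  subst heq
  exact le_rfl

/-- Since `h = p / U`, the factor `p ∂ₜ log h` equals `∂ₜp - h ∂ₜU`. -/
lemma hasDerivAt_mul_log_densityRatio (hp : IsRegularDensity T ν p)
    (hu : IsRegularDensity T (fun s => (f s : Measure (Space d))) u) {s : ℝ} (hs : s ∈ Ioo 0 T)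
    (x : Config N d) :
    HasDerivAt (fun r => p r x * Real.log (densityRatio p u r x))
      (deriv (fun r => p r x) s * (Real.log (densityRatio p u s x) + 1)
        - deriv (fun r => tensorDensity N u r x) s * densityRatio p u s x) s := by
  have hP := hp.hasDerivAt hs x
  have hU := (hasDerivAt_tensorDensity (N := N) hu hs x).differentiableAt.hasDerivAt
  have hp0 := (hp.pos s hs x).ne'
  have hU0 := (tensorDensity_pos hu hs x).ne'
  have hr := (hP.fun_div hU hU0).log (div_ne_zero hp0 hU0)
  refine (hP.mul hr).congr_deriv ?_
  simp only [densityRatio_eq]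
  field_simp
  ring

lemma continuous_deriv_mul_log_densityRatio (hp : IsRegularDensity T ν p)
    (hu : IsRegularDensity T (fun s => (f s : Measure (Space d))) u) {s : ℝ} (hs : s ∈ Ioo 0 T) :
    Continuous fun x => deriv (fun r => p r x * Real.log (densityRatio p u r x)) s := by
  simp only [(hasDerivAt_mul_log_densityRatio hp hu hs _).deriv]
  exact ((hp.continuous_deriv hs).mul
    ((contDiff_log_densityRatio hp hu hs).continuous.add continuous_const)).sub
    ((continuous_deriv_tensorDensity hu hs).mul (contDiff_densityRatio hp hu hs).continuous)

/-- Under local domination of the time derivative of the entropy density, finiteness of the entropy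
propagates to nearby times, and the entropy may be differentiated under the integral. -/
lemma hasDerivAt_entropy (hp : IsRegularDensity T ν p)
    (hu : IsRegularDensity T (fun s => (f s : Measure (Space d))) u) {s : ℝ} (hs : s ∈ Ioo 0 T)
    (hν : ∀ r ∈ Ioo 0 T, IsProbabilityMeasure (ν r))
    (hH : klDiv (ν s) (tensorPower N (f s)) ≠ ∞)
    (hdom : ∃ g : Config N d → ℝ, Integrable g volume ∧ ∀ᶠ r in 𝓝 s, ∀ x,
      |deriv (fun r => p r x * Real.log (densityRatio p u r x)) r| ≤ g x) :
    (∀ᶠ r in 𝓝 s, klDiv (ν r) (tensorPower N (f r)) ≠ ∞) ∧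
      Integrable (fun x => deriv (fun r => p r x * Real.log (densityRatio p u r x)) s) ∧
      HasDerivAt (fun r => (klDiv (ν r) (tensorPower N (f r))).toReal)
        (∫ x, deriv (fun r => p r x * Real.log (densityRatio p u r x)) s) s := by
  obtain ⟨g, hg, hgs⟩ := hdom
  have hIoo := isOpen_Ioo.mem_nhds hs
  have hint := (klDiv_tensorPower_ne_top_iff hp hu hs).1 hH
  obtain ⟨ε, hε, hball⟩ := Metric.eventually_nhds_iff_ball.1 (hgs.and hIoo)
  have hder : ∀ r ∈ Metric.ball s ε, ∀ x,
      HasDerivAt (fun r => p r x * Real.log (densityRatio p u r x))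
        (deriv (fun r => p r x * Real.log (densityRatio p u r x)) r) r := fun r hr x =>
    (hasDerivAt_mul_log_densityRatio hp hu (hball r hr).2 x).differentiableAt.hasDerivAt
  have hmeas : ∀ r ∈ Ioo 0 T, AEStronglyMeasurable
      (fun x => p r x * Real.log (densityRatio p u r x)) volume := fun r hr =>
    ((hp.continuous hr).mul (contDiff_log_densityRatio hp hu hr).continuous).aestronglyMeasurable
  have hD := hasDerivAt_integral_of_dominated_loc_of_deriv_le (Metric.ball_mem_nhds s hε)
    (by filter_upwards [hIoo] with r hr using hmeas r hr) hint
    (continuous_deriv_mul_log_densityRatio hp hu hs).aestronglyMeasurable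
    (ae_of_all _ fun x r hr => (hball r hr).1 x) hg (ae_of_all _ fun x r hr => hder r hr x)
  refine ⟨?_, hD.1, hD.2.congr_of_eventuallyEq ?_⟩
  · filter_upwards [Metric.ball_mem_nhds s hε] with r hr
    have hrT := (hball r hr).2
    refine (klDiv_tensorPower_ne_top_iff hp hu hrT).2 ?_
    -- By the mean value inequality the entropy density changes by at most `g x * |r - s|` between
    -- times `s` and `r`.
    refine (hint.norm.add (hg.mul_const |r - s|)).mono' (hmeas r hrT) (ae_of_all _ fun x => ?_)
    have := (convex_ball s ε).norm_image_sub_le_of_norm_hasDerivWithin_le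
      (fun y hy => (hder y hy x).hasDerivWithinAt) (fun y hy => (hball y hy).1 x)
      (Metric.mem_ball_self hε) hr
    rw [← sub_add_cancel (p r x * Real.log (densityRatio p u r x))
      (p s x * Real.log (densityRatio p u s x))]
    refine (norm_add_le _ _).trans ?_
    rw [add_comm]
    exact add_le_add_right this _
  · filter_upwards [hIoo] with r hr
    have : IsProbabilityMeasure (ν r) := hν r hr
    exact toReal_klDiv_tensorPower hp hu hr

end Ratio

/-! ### Cutoffs obtained by scaling one bump function. -/

section Cutoff

variable {N d : ℕ}

/-- Smooth cutoffs on the configuration space, with gradients bounded by `C / (1 + |x|)`. -/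
lemma exists_cutoff (N d : ℕ) : ∃ (χ : ℕ → Config N d → ℝ) (C : ℝ), 0 ≤ C ∧
    (∀ n, ContDiff ℝ 2 (χ n)) ∧ (∀ n, HasCompactSupport (χ n)) ∧
    (∀ n x, 0 ≤ χ n x ∧ χ n x ≤ 1) ∧ (∀ x, Tendsto (fun n => χ n x) atTop (𝓝 1)) ∧
    (∀ n i x, ‖particleGradient (χ n) i x‖ ≤ C / (n + 1)) ∧
    (∀ n i x, ‖particleGradient (χ n) i x‖ ≤ C / (1 + ‖x‖)) ∧
    (∀ n i x, |particleLaplacian (χ n) i x| ≤ C / (n + 1)) := by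
  let ψ : ContDiffBump (0 : Config N d) := ⟨1, 2, one_pos, one_lt_two⟩
  have hψ : ContDiff ℝ 2 ψ := ψ.contDiff
  have hψK : HasCompactSupport ψ := ψ.hasCompactSupport
  have hG : ∀ i, ∃ C, ∀ x, ‖particleGradient ψ i x‖ ≤ C := fun i =>
    (hasCompactSupport_particleGradient hψK i).exists_bound_of_continuous
      (continuous_particleGradient (hψ.of_le one_le_two) i)
  have hL : ∀ i, ∃ C, ∀ x, ‖particleLaplacian ψ i x‖ ≤ C := fun i =>
    (hasCompactSupport_particleLaplacian hψK i).exists_bound_of_continuous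
      (continuous_particleLaplacian hψ i)
  choose G hG using hG
  choose L hL using hL
  have hG0 : ∀ i, 0 ≤ G i := fun i => (norm_nonneg _).trans (hG i 0)
  have hL0 : ∀ i, 0 ≤ L i := fun i => (norm_nonneg _).trans (hL i 0)
  set B : ℝ := ∑ i, (G i + L i) with hB
  have hB0 : 0 ≤ B := Finset.sum_nonneg fun i _ => add_nonneg (hG0 i) (hL0 i)
  have hle : ∀ i, G i + L i ≤ B := fun i =>
    Finset.single_le_sum (f := fun i => G i + L i) (fun i _ => add_nonneg (hG0 i) (hL0 i))
      (Finset.mem_univ i)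
  have hc : ∀ n : ℕ, (0 : ℝ) < (n : ℝ) + 1 := fun n => by positivity
  have hgrad : ∀ (n : ℕ) i x, ‖particleGradient (fun y => ψ (((n : ℝ) + 1)⁻¹ • y)) i x‖ ≤
      B / (n + 1) := by
    intro n i x
    rw [particleGradient_comp_smul, norm_smul, Real.norm_of_nonneg (inv_pos.2 (hc n)).le,
      div_eq_inv_mul]
    gcongr
    exact (hG i _).trans ((le_add_of_nonneg_right (hL0 i)).trans (hle i))
  refine ⟨fun n x => ψ (((n : ℝ) + 1)⁻¹ • x), 3 * B, by positivity,
    fun n => hψ.comp (contDiff_const_smul _), fun n => ?_, fun n x => ⟨ψ.nonneg, ψ.le_one⟩,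
    fun x => ?_, fun n i x => (hgrad n i x).trans ?_, fun n i x => ?_, fun n i x => ?_⟩
  · exact hψK.comp_smul (inv_pos.2 (hc n)).ne'
  · refine tendsto_const_nhds.congr' ?_
    filter_upwards [eventually_ge_atTop ⌈‖x‖⌉₊] with n hn
    refine (ψ.one_of_mem_closedBall ?_).symm
    rw [mem_closedBall_zero_iff, norm_smul, Real.norm_of_nonneg (inv_pos.2 (hc n)).le,
      inv_mul_le_iff₀ (hc n)]
    have := Nat.ceil_le.1 hn
    change ‖x‖ ≤ (n + 1) * 1
    linarith
  · have := hc n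
    gcongr
    linarith
  -- Where the gradient may be nonzero, `‖x‖ ≤ 2(n + 1)`, so `1 + ‖x‖ ≤ 3(n + 1)`; this is the
  -- origin of the constant `3 * B`.
  · by_cases hx : (((n : ℝ) + 1)⁻¹ • x) ∈ tsupport ψ
    · refine (hgrad n i x).trans ?_
      rw [ψ.tsupport_eq, mem_closedBall_zero_iff, norm_smul,
        Real.norm_of_nonneg (inv_pos.2 (hc n)).le, inv_mul_le_iff₀ (hc n)] at hx
      have hx' : ‖x‖ ≤ (n + 1) * 2 := hx
      have := hc n
      have hn : (0 : ℝ) ≤ n := n.cast_nonneg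
      rw [div_le_div_iff₀ this (by positivity)]
      nlinarith [norm_nonneg x]
    · rw [particleGradient_comp_smul, particleGradient_eq_zero hx, smul_zero, norm_zero]
      positivity
  · rw [particleLaplacian_comp_smul hψ, abs_mul, abs_of_nonneg (by positivity), div_eq_inv_mul]
    -- Scaling produces `(n + 1)⁻²`; one factor is enough and the other is bounded by `1`.
    have h1 : ((n : ℝ) + 1)⁻¹ ≤ 1 := inv_le_one_of_one_le₀ (by linarith [n.cast_nonneg (α := ℝ)])
    have h2 := (hL i (((n : ℝ) + 1)⁻¹ • x)).trans ((le_add_of_nonneg_left (hG0 i)).trans (hle i))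
    have h3 := (inv_pos.2 (hc n))
    rw [Real.norm_eq_abs] at h2
    rw [sq, mul_assoc]
    gcongr
    nlinarith [abs_nonneg (particleLaplacian ψ i (((n : ℝ) + 1)⁻¹ • x))]

end Cutoff

/-! ### Removal of the truncation, and the localized dissipation. -/

section Dissipation

/-- If the truncated dissipation integrals converge, then the energy `W` is integrable and the
truncation may be removed. -/
lemma integrable_and_integral_eq_of_tendsto_cutoff {α : Type*} {mα : MeasurableSpace α}
    {ν : Measure α} {A W S : α → ℝ} {χ : ℕ → α → ℝ} {D : ℝ}
    (hA : AEStronglyMeasurable A ν) (hWm : AEStronglyMeasurable W ν) (hW : ∀ x, 0 ≤ W x)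
    (hS : Integrable S ν) (hS0 : ∀ x, 0 ≤ S x) (hχm : ∀ n, AEStronglyMeasurable (χ n) ν)
    (hχ : ∀ n x, 0 ≤ χ n x ∧ χ n x ≤ 1) (hχ1 : ∀ x, Tendsto (fun n => χ n x) atTop (𝓝 1))
    (hAW : ∀ a : ℝ, 0 < a → ∀ x, |A x| ≤ a / 2 * W x + 1 / (2 * a) * S x)
    (hint : ∀ n, Integrable (fun x => χ n x * (A x - 1 / 2 * W x)) ν)
    (hD : Tendsto (fun n => ∫ x, χ n x * (A x - 1 / 2 * W x) ∂ν) atTop (𝓝 D)) :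
    Integrable W ν ∧ Integrable A ν ∧ D = ∫ x, (A x - 1 / 2 * W x) ∂ν := by
  have hχS : ∀ n, Integrable (fun x => χ n x * S x) ν := fun n =>
    hS.mono ((hχm n).mul hS.1) (ae_of_all _ fun x => by
      rw [norm_mul, Real.norm_of_nonneg (hχ n x).1]
      exact mul_le_of_le_one_left (norm_nonneg _) (hχ n x).2)
  have hbound : ∀ n, ∫⁻ x, ENNReal.ofReal (χ n x * W x) ∂ν ≤
      ENNReal.ofReal (4 * (∫ x, S x ∂ν - ∫ x, χ n x * (A x - 1 / 2 * W x) ∂ν)) := by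
    intro n
    have hle : ∀ x, χ n x * W x ≤ 4 * (χ n x * S x - χ n x * (A x - 1 / 2 * W x)) := fun x => by
      -- The choice `a = 1/2` gives `A ≤ W/4 + S`, which consumes only half of the available `W/2`;
      -- the surviving quarter gives the factor `4`.
      have h1 := (abs_le.1 (hAW (1 / 2) one_half_pos x)).2
      have h2 : 0 ≤ χ n x * (1 / 4 * W x + S x - A x) := mul_nonneg (hχ n x).1 (by linarith)
      linarith
    have hi : Integrable (fun x => 4 * (χ n x * S x - χ n x * (A x - 1 / 2 * W x))) ν :=
      ((hχS n).sub (hint n)).const_mul 4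
    calc ∫⁻ x, ENNReal.ofReal (χ n x * W x) ∂ν
        ≤ ∫⁻ x, ENNReal.ofReal (4 * (χ n x * S x - χ n x * (A x - 1 / 2 * W x))) ∂ν :=
          lintegral_mono fun x => ENNReal.ofReal_le_ofReal (hle x)
      _ = ENNReal.ofReal (4 * (∫ x, χ n x * S x ∂ν - ∫ x, χ n x * (A x - 1 / 2 * W x) ∂ν)) := by
          rw [← ofReal_integral_eq_lintegral_ofReal hi (ae_of_all _ fun x =>
            (mul_nonneg (hχ n x).1 (hW x)).trans (hle x)), integral_const_mul,
            integral_sub (hχS n) (hint n)]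
      _ ≤ _ := by
          refine ENNReal.ofReal_le_ofReal ?_
          have := integral_mono (hχS n) hS fun x =>
            mul_le_of_le_one_left (hS0 x) (hχ n x).2
          linarith
  have hWi : Integrable W ν := by
    refine ⟨hWm, ?_⟩
    rw [hasFiniteIntegral_iff_ofReal (ae_of_all _ hW)]
    have hlim : ∀ x, liminf (fun n => ENNReal.ofReal (χ n x * W x)) atTop =
        ENNReal.ofReal (W x) := fun x => by
      have := ENNReal.tendsto_ofReal ((hχ1 x).mul_const (W x))
      rw [one_mul] at this
      exact this.liminf_eq
    have hlim2 := ENNReal.tendsto_ofReal ((hD.const_sub (∫ x, S x ∂ν)).const_mul 4)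
    -- Fatou's lemma: the bounds on the truncated energies converge because the truncated
    -- dissipation does.
    calc ∫⁻ x, ENNReal.ofReal (W x) ∂ν
        = ∫⁻ x, liminf (fun n => ENNReal.ofReal (χ n x * W x)) atTop ∂ν := by simp only [hlim]
      _ ≤ liminf (fun n => ∫⁻ x, ENNReal.ofReal (χ n x * W x) ∂ν) atTop :=
          lintegral_liminf_le' fun n => ((hχm n).mul hWm).aemeasurable.ennreal_ofReal
      _ ≤ liminf (fun n => ENNReal.ofReal
            (4 * (∫ x, S x ∂ν - ∫ x, χ n x * (A x - 1 / 2 * W x) ∂ν))) atTop :=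
          liminf_le_liminf (Eventually.of_forall hbound)
      _ = _ := hlim2.liminf_eq
      _ < ∞ := ENNReal.ofReal_lt_top
  have hAi : Integrable A ν :=
    ((hWi.const_mul (1 / 2)).add (hS.const_mul (1 / (2 * 1)))).mono' hA
      (ae_of_all _ fun x => hAW 1 one_pos x)
  have hAWi : Integrable (fun x => A x - 1 / 2 * W x) ν := hAi.sub (hWi.const_mul _)
  refine ⟨hWi, hAi, tendsto_nhds_unique hD ?_⟩
  refine tendsto_integral_of_dominated_convergence (fun x => ‖A x - 1 / 2 * W x‖)
    (fun n => (hint n).1) hAWi.norm (fun n => ae_of_all _ fun x => ?_) (ae_of_all _ fun x => ?_)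
  · rw [norm_mul, Real.norm_of_nonneg (hχ n x).1]
    exact mul_le_of_le_one_left (norm_nonneg _) (hχ n x).2
  · simpa using (hχ1 x).mul_const (A x - 1 / 2 * W x)

variable {N d : ℕ} [NeZero N] {Ω : Type*} {mΩ : MeasurableSpace Ω} {P : Measure Ω}
  {b : Space d → ProbabilityMeasure (Space d) → Space d} {T : ℝ}
  {ℱ : Filtration (Icc (0 : ℝ) T) mΩ} {X : ℝ → Ω → Config N d}
  {p : ℝ → Config N d → ℝ} {f : ℝ → ProbabilityMeasure (Space d)} {u : ℝ → Space d → ℝ}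

/-- The difference between the drift of the `i`-th particle and the drift of the limit equation. -/
def driftGap (b : Space d → ProbabilityMeasure (Space d) → Space d)
    (μ : ProbabilityMeasure (Space d)) (i : Fin N) (x : Config N d) : Space d :=
  b (x i) (empiricalMeasure x) - b (x i) μ

lemma measurable_driftGap (hb : Measurable (Function.uncurry b)) (μ : ProbabilityMeasure (Space d))
    (i : Fin N) : Measurable (driftGap (N := N) b μ i) :=
  have hbm : Measurable fun y => b y μ := hb.comp (measurable_id.prodMk measurable_const)
  (measurable_drift hb i).sub (hbm.comp (measurable_pi_apply i))

/-- The entropy dissipation localized by a cutoff `χ`. -/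
lemma integral_cutoff_mul_deriv_entropy_density [IsProbabilityMeasure P]
    (hX : IsParticleSystem b T ℱ P X)
    (hf : IsMcKeanVlasovSolution b T f) (hb : Measurable (Function.uncurry b))
    (hp : IsRegularDensity T (fun s => P.map (X s)) p)
    (hu : IsRegularDensity T (fun s => (f s : Measure (Space d))) u) {t : ℝ} (ht : t ∈ Ioo 0 T)
    {χ : Config N d → ℝ} (hχ : ContDiff ℝ 2 χ) (hχK : HasCompactSupport χ)
    {ℓ : Config N d → ℝ} (hℓ : ℓ = fun x => Real.log (densityRatio p u t x)) :
    Integrable (fun x => ∑ i, (χ x * (⟪driftGap b (f t) i x, particleGradient ℓ i x⟫_ℝ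
          - 1 / 2 * ‖particleGradient ℓ i x‖ ^ 2)
        + ⟪driftGap b (f t) i x, particleGradient χ i x⟫_ℝ
        + ℓ x * ⟪b (x i) (empiricalMeasure x), particleGradient χ i x⟫_ℝ
        + 1 / 2 * (ℓ x * particleLaplacian χ i x))) (P.map (X t)) ∧
    ∫ x, χ x * deriv (fun r => p r x * Real.log (densityRatio p u r x)) t =
      ∫ x, ∑ i, (χ x * (⟪driftGap b (f t) i x, particleGradient ℓ i x⟫_ℝ
          - 1 / 2 * ‖particleGradient ℓ i x‖ ^ 2)
        + ⟪driftGap b (f t) i x, particleGradient χ i x⟫_ℝ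
        + ℓ x * ⟪b (x i) (empiricalMeasure x), particleGradient χ i x⟫_ℝ
        + 1 / 2 * (ℓ x * particleLaplacian χ i x)) ∂(P.map (X t)) := by
  have hℓC : ContDiff ℝ 2 ℓ := hℓ ▸ contDiff_log_densityRatio hp hu ht
  have hexp : ∀ x, Real.exp (ℓ x) = densityRatio p u t x := fun x => by
    rw [hℓ]
    exact Real.exp_log (densityRatio_pos hp hu ht x)
  have hUexp : ∀ x, tensorDensity N u t x * Real.exp (ℓ x) = p t x := fun x => by
    rw [hexp, densityRatio_eq, mul_div_cancel₀ _ (tensorDensity_pos hu ht x).ne']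
  -- The test functions are the coefficients of `∂ₜp` and `-∂ₜU` in `∂ₜ(p log h)`, times the cutoff.
  set φ₁ : Config N d → ℝ := fun x => χ x * (ℓ x + 1) with hφ₁
  set φ₂ : Config N d → ℝ := fun x => χ x * Real.exp (ℓ x) with hφ₂
  have h1C : ContDiff ℝ 2 φ₁ := hχ.mul (hℓC.add contDiff_const)
  have h2C : ContDiff ℝ 2 φ₂ := hχ.mul hℓC.exp
  have h1K : HasCompactSupport φ₁ := hχK.mul_right
  have h2K : HasCompactSupport φ₂ := hχK.mul_right
  obtain ⟨hI1, hE1⟩ := hX.integral_deriv_density hb hp ht h1C h1K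
  have hE2 := hf.integral_deriv_tensorDensity hb hu ht h2C h2K
  have hI2 : Integrable fun x => ∑ i, tensorDensity N u t x *
      generator b (f t) (slice φ₂ i x) (x i) :=
    integrable_finsetSum _ fun i _ => hf.integrable_generator_slice hb hu ht h2C h2K i
  have hpt : ∀ x, p t x * particleGenerator b φ₁ x
      - ∑ i, tensorDensity N u t x * generator b (f t) (slice φ₂ i x) (x i) =
      p t x * ∑ i, (χ x * (⟪driftGap b (f t) i x, particleGradient ℓ i x⟫_ℝ
          - 1 / 2 * ‖particleGradient ℓ i x‖ ^ 2)
        + ⟪driftGap b (f t) i x, particleGradient χ i x⟫_ℝ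
        + ℓ x * ⟪b (x i) (empiricalMeasure x), particleGradient χ i x⟫_ℝ
        + 1 / 2 * (ℓ x * particleLaplacian χ i x)) := by
    intro x
    rw [particleGenerator, Finset.mul_sum, Finset.mul_sum, ← Finset.sum_sub_distrib]
    refine Finset.sum_congr rfl fun i _ => ?_
    have := entropy_dissipation_identity (hχ.slice i x) (hℓC.slice i x)
      (b (x i) (empiricalMeasure x)) (b (x i) (f t)) (x i)
    simp only [slice_apply_self] at this
    rw [← hUexp, mul_assoc, ← mul_sub, mul_assoc]
    exact congrArg _ this
  refine ⟨?_, ?_⟩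
  · rw [hp.integrable_iff ht]
    exact (hI1.sub hI2).congr (ae_of_all _ hpt)
  · rw [hp.integral_eq ht]
    simp only [← hpt]
    rw [integral_sub hI1 hI2, ← hE1, ← hE2, ← integral_sub]
    · refine integral_congr_ae (ae_of_all _ fun x => ?_)
      simp only [(hasDerivAt_mul_log_densityRatio hp hu ht x).deriv, hφ₁, hφ₂, hexp]
      rw [hℓ]
      ring
    · exact ((hp.continuous_deriv ht).mul h1C.continuous).integrable_of_hasCompactSupport
        h1K.mul_left
    · exact ((continuous_deriv_tensorDensity hu ht).mul
        h2C.continuous).integrable_of_hasCompactSupport h2K.mul_left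

lemma empiricalMeasure_comp_perm (x : Config N d) (τ : Equiv.Perm (Fin N)) :
    empiricalMeasure (x ∘ τ) = empiricalMeasure x := by
  refine Subtype.ext ?_
  simp only [empiricalMeasure, Function.comp_apply]
  rw [Equiv.sum_comp τ fun i => Measure.dirac (x i)]

/-- By exchangeability the gaps of all the particles have the same mean square. -/
lemma IsParticleSystem.integrable_and_integral_driftGap (hX : IsParticleSystem b T ℱ P X)
    (hb : Measurable (Function.uncurry b)) {t : ℝ} (ht : t ∈ Icc 0 T)
    (μ : ProbabilityMeasure (Space d))
    (hE : Integrable (fun ω => ‖driftGap b μ 0 (X t ω)‖ ^ 2) P) (i : Fin N) :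
    Integrable (fun x => ‖driftGap b μ i x‖ ^ 2) (P.map (X t)) ∧
      ∫ x, ‖driftGap b μ i x‖ ^ 2 ∂(P.map (X t)) = ∫ ω, ‖driftGap b μ 0 (X t ω)‖ ^ 2 ∂P := by
  have hXm := hX.measurable ht
  have hm : ∀ j, AEStronglyMeasurable (fun x : Config N d => ‖driftGap b μ j x‖ ^ 2)
      (P.map (X t)) := fun j => ((measurable_driftGap hb μ j).norm.pow_const 2).aestronglyMeasurable
  -- The swap carries the gap of particle `0` to that of particle `i`, the empirical measure being
  -- invariant.
  let τ : Equiv.Perm (Fin N) := Equiv.swap 0 i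
  have hτm : Measurable fun x : Config N d => x ∘ τ :=
    measurable_pi_lambda _ fun j => measurable_pi_apply (τ j)
  have hmp : MeasurePreserving (fun x : Config N d => x ∘ τ) (P.map (X t)) (P.map (X t)) := by
    refine ⟨hτm, ?_⟩
    rw [Measure.map_map hτm hXm]
    exact hX.exchangeable t ht τ
  have hcomp : ((fun x : Config N d => ‖driftGap b μ 0 x‖ ^ 2) ∘ fun x => x ∘ τ) =
      fun x => ‖driftGap b μ i x‖ ^ 2 := by
    ext x
    simp [driftGap, empiricalMeasure_comp_perm, τ]
  have hI0 : Integrable (fun x => ‖driftGap b μ 0 x‖ ^ 2) (P.map (X t)) :=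
    (integrable_map_measure (hm 0) hXm.aemeasurable).2 hE
  refine ⟨hcomp ▸ (hmp.integrable_comp (hm 0)).2 hI0, ?_⟩
  rw [← integral_map hXm.aemeasurable (hm 0)]
  conv_rhs => rw [← hmp.map_eq]
  rw [integral_map hτm.aemeasurable (hmp.map_eq.symm ▸ hm 0)]
  exact congrArg (fun F => ∫ x, F x ∂(P.map (X t))) hcomp.symm

end Dissipation

/-! ### Vanishing of the cutoff terms, and Young's inequality. -/

section Remainder

variable {N d : ℕ}

/-- The terms of the localized dissipation which contain derivatives of the cutoffs vanish in the
limit. -/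
lemma tendsto_integral_cutoff_remainder {ν : Measure (Config N d)} [IsFiniteMeasure ν]
    {χ : ℕ → Config N d → ℝ} {C : ℝ} (hC : 0 ≤ C) (hχ : ∀ n, ContDiff ℝ 2 (χ n))
    (hg1 : ∀ n i x, ‖particleGradient (χ n) i x‖ ≤ C / (n + 1))
    (hg2 : ∀ n i x, ‖particleGradient (χ n) i x‖ ≤ C / (1 + ‖x‖))
    (hl : ∀ n i x, |particleLaplacian (χ n) i x| ≤ C / (n + 1))
    {B β : Fin N → Config N d → Space d} {ℓ : Config N d → ℝ} (hB : ∀ i, Measurable (B i))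
    (hβ : ∀ i, Measurable (β i)) (hβ2 : ∀ i, Integrable (fun x => ‖β i x‖ ^ 2) ν)
    (hℓm : Measurable ℓ) (hℓ : Integrable ℓ ν)
    (hBℓ : ∀ i, Integrable (fun x => ‖B i x‖ * |ℓ x| / (1 + ‖x‖)) ν) :
    (∀ n, Integrable (fun x => ∑ i, (⟪β i x, particleGradient (χ n) i x⟫_ℝ
      + ℓ x * ⟪B i x, particleGradient (χ n) i x⟫_ℝ
      + 1 / 2 * (ℓ x * particleLaplacian (χ n) i x))) ν) ∧
    Tendsto (fun n => ∫ x, ∑ i, (⟪β i x, particleGradient (χ n) i x⟫_ℝ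
      + ℓ x * ⟪B i x, particleGradient (χ n) i x⟫_ℝ
      + 1 / 2 * (ℓ x * particleLaplacian (χ n) i x)) ∂ν) atTop (𝓝 0) := by
  have hm : ∀ n, AEStronglyMeasurable (fun x => ∑ i, (⟪β i x, particleGradient (χ n) i x⟫_ℝ
      + ℓ x * ⟪B i x, particleGradient (χ n) i x⟫_ℝ
      + 1 / 2 * (ℓ x * particleLaplacian (χ n) i x))) ν := fun n => by
    refine (Finset.measurable_sum _ fun i _ => ?_).aestronglyMeasurable
    have h1 := (continuous_particleGradient ((hχ n).of_le one_le_two) i).measurable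
    have h2 := (continuous_particleLaplacian (hχ n) i).measurable
    exact (((hβ i).inner h1).add (hℓm.mul ((hB i).inner h1))).add ((hℓm.mul h2).const_mul _)
  have hβ1 : ∀ i, Integrable (fun x => ‖β i x‖) ν := fun i =>
    ((integrable_const (1 : ℝ)).add (hβ2 i)).mono' (hβ i).norm.aestronglyMeasurable
      (ae_of_all _ fun x => by
        rw [norm_norm, Pi.add_apply]
        nlinarith [sq_nonneg (‖β i x‖ - 1)])
  have hterm : ∀ n i x, ‖⟪β i x, particleGradient (χ n) i x⟫_ℝ
      + ℓ x * ⟪B i x, particleGradient (χ n) i x⟫_ℝ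
      + 1 / 2 * (ℓ x * particleLaplacian (χ n) i x)‖ ≤
      ‖β i x‖ * ‖particleGradient (χ n) i x‖ + |ℓ x| * (‖B i x‖ * ‖particleGradient (χ n) i x‖)
        + |ℓ x| * |particleLaplacian (χ n) i x| := fun n i x => by
    refine (norm_add₃_le ..).trans ?_
    simp only [norm_mul, Real.norm_eq_abs]
    have h1 := abs_real_inner_le_norm (β i x) (particleGradient (χ n) i x)
    have h2 := mul_le_mul_of_nonneg_left
      (abs_real_inner_le_norm (B i x) (particleGradient (χ n) i x)) (abs_nonneg (ℓ x))
    have h3 := mul_nonneg (abs_nonneg (ℓ x)) (abs_nonneg (particleLaplacian (χ n) i x))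
    rw [abs_of_pos (by norm_num : (0 : ℝ) < 1 / 2)]
    linarith
  have hn1 : ∀ n : ℕ, C / ((n : ℝ) + 1) ≤ C := fun n =>
    div_le_self hC (by linarith [n.cast_nonneg (α := ℝ)])
  -- For domination, the weighted gradient bound is reserved for the term with `B`, where only `‖B‖
  -- |ℓ| / (1 + ‖x‖)` is integrable. The pointwise limit below uses the uniform `C / (n + 1)`
  -- throughout.
  set bound : Config N d → ℝ := fun x =>
    ∑ i, (C * ‖β i x‖ + C * (‖B i x‖ * |ℓ x| / (1 + ‖x‖)) + C * |ℓ x|) with hbound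
  have hbi : Integrable bound ν := integrable_finsetSum _ fun i _ =>
    (((hβ1 i).const_mul C).add ((hBℓ i).const_mul C)).add (hℓ.abs.const_mul C)
  have hb : ∀ n x, ‖∑ i, (⟪β i x, particleGradient (χ n) i x⟫_ℝ
      + ℓ x * ⟪B i x, particleGradient (χ n) i x⟫_ℝ
      + 1 / 2 * (ℓ x * particleLaplacian (χ n) i x))‖ ≤ bound x := fun n x => by
    refine (norm_sum_le _ _).trans (Finset.sum_le_sum fun i _ => (hterm n i x).trans ?_)
    have h1 := mul_le_mul_of_nonneg_left ((hg1 n i x).trans (hn1 n)) (norm_nonneg (β i x))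
    have h2 := mul_le_mul_of_nonneg_left (hg2 n i x)
      (mul_nonneg (abs_nonneg (ℓ x)) (norm_nonneg (B i x)))
    have h3 := mul_le_mul_of_nonneg_left ((hl n i x).trans (hn1 n)) (abs_nonneg (ℓ x))
    have h4 : C * (‖B i x‖ * |ℓ x| / (1 + ‖x‖)) = |ℓ x| * ‖B i x‖ * (C / (1 + ‖x‖)) := by ring
    linarith
  refine ⟨fun n => hbi.mono' (hm n) (ae_of_all _ (hb n)), ?_⟩
  rw [← integral_zero (Config N d) ℝ (μ := ν)]
  refine tendsto_integral_of_dominated_convergence bound hm hbi (fun n => ae_of_all _ (hb n))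
    (ae_of_all _ fun x => ?_)
  have hlim : Tendsto
      (fun n : ℕ => (∑ i, (‖β i x‖ + |ℓ x| * ‖B i x‖ + |ℓ x|)) * (C / ((n : ℝ) + 1)))
      atTop (𝓝 0) := by
    have h := (tendsto_one_div_add_atTop_nhds_zero_nat (𝕜 := ℝ)).const_mul
      ((∑ i, (‖β i x‖ + |ℓ x| * ‖B i x‖ + |ℓ x|)) * C)
    rw [mul_zero] at h
    refine h.congr fun n => ?_
    ring
  refine squeeze_zero_norm (fun n => ?_) hlim
  rw [Finset.sum_mul]
  refine (norm_sum_le _ _).trans (Finset.sum_le_sum fun i _ => (hterm n i x).trans ?_)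
  have h1 := mul_le_mul_of_nonneg_left (hg1 n i x) (norm_nonneg (β i x))
  have h2 := mul_le_mul_of_nonneg_left (hg1 n i x)
    (mul_nonneg (abs_nonneg (ℓ x)) (norm_nonneg (B i x)))
  have h3 := mul_le_mul_of_nonneg_left (hl n i x) (abs_nonneg (ℓ x))
  linarith

/-- Expand `(a ‖v‖ - ‖β‖)² ≥ 0`. The parameter is kept free: fixed values give integrability, and
`α` gives the final estimate. -/
lemma abs_sum_inner_le {E : Type*} [NormedAddCommGroup E] [InnerProductSpace ℝ E] {a : ℝ}
    (ha : 0 < a) (β v : Fin N → E) :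
    |∑ i, ⟪β i, v i⟫_ℝ| ≤ a / 2 * ∑ i, ‖v i‖ ^ 2 + 1 / (2 * a) * ∑ i, ‖β i‖ ^ 2 := by
  rw [Finset.mul_sum, Finset.mul_sum, ← Finset.sum_add_distrib]
  refine (Finset.abs_sum_le_sum_abs _ _).trans (Finset.sum_le_sum fun i _ => ?_)
  refine (abs_real_inner_le_norm _ _).trans ?_
  have h : a / 2 * ‖v i‖ ^ 2 + 1 / (2 * a) * ‖β i‖ ^ 2 - ‖β i‖ * ‖v i‖ =
      (a * ‖v i‖ - ‖β i‖) ^ 2 / (2 * a) := by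
    field_simp
    ring
  have : 0 ≤ (a * ‖v i‖ - ‖β i‖) ^ 2 / (2 * a) := by positivity
  linarith

end Remainder

/-! ### The entropy dissipation identity without cutoff. -/

section Main

variable {N d : ℕ} [NeZero N] {Ω : Type*} {mΩ : MeasurableSpace Ω} {P : Measure Ω}
  [IsProbabilityMeasure P] {b : Space d → ProbabilityMeasure (Space d) → Space d} {T : ℝ}
  {ℱ : Filtration (Icc (0 : ℝ) T) mΩ} {X : ℝ → Ω → Config N d}
  {p : ℝ → Config N d → ℝ} {f : ℝ → ProbabilityMeasure (Space d)} {u : ℝ → Space d → ℝ}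

/-- The entropy dissipation identity: the time derivative of the entropy is
`𝔼[∑ᵢ ⟨βᵢ, ∇ᵢ log h⟩ - ½ |∇ log h|²]`, where `β` is the gap between the drifts. -/
lemma integral_deriv_entropy_density_eq (hX : IsParticleSystem b T ℱ P X)
    (hf : IsMcKeanVlasovSolution b T f) (hb : Measurable (Function.uncurry b))
    (hp : IsRegularDensity T (fun s => P.map (X s)) p)
    (hu : IsRegularDensity T (fun s => (f s : Measure (Space d))) u) {t : ℝ} (ht : t ∈ Ioo 0 T)
    {ℓ : Config N d → ℝ} (hℓ : ℓ = fun x => Real.log (densityRatio p u t x))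
    (hint : Integrable (fun x => deriv (fun r => p r x * Real.log (densityRatio p u r x)) t))
    (hH : klDiv (P.map (X t)) (tensorPower N (f t)) ≠ ∞)
    (hE : Integrable (fun ω => ‖driftGap b (f t) 0 (X t ω)‖ ^ 2) P)
    (hgrowth : ∀ i, Integrable (fun ω => ‖b (X t ω i) (empiricalMeasure (X t ω))‖
      * |ℓ (X t ω)| / (1 + ‖X t ω‖)) P) :
    Integrable (fun x => ∑ i, ‖particleGradient ℓ i x‖ ^ 2) (P.map (X t)) ∧
    Integrable (fun x => ∑ i, ⟪driftGap b (f t) i x, particleGradient ℓ i x⟫_ℝ) (P.map (X t)) ∧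
    ∫ x, deriv (fun r => p r x * Real.log (densityRatio p u r x)) t =
      ∫ x, (∑ i, ⟪driftGap b (f t) i x, particleGradient ℓ i x⟫_ℝ
        - 1 / 2 * ∑ i, ‖particleGradient ℓ i x‖ ^ 2) ∂(P.map (X t)) := by
  have htI := Ioo_subset_Icc_self ht
  have hXm := hX.measurable htI
  have : IsProbabilityMeasure (P.map (X t)) := Measure.isProbabilityMeasure_map hXm.aemeasurable
  have hℓC : ContDiff ℝ 2 ℓ := hℓ ▸ contDiff_log_densityRatio hp hu ht
  have hℓi : Integrable ℓ (P.map (X t)) := by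
    rw [hp.integrable_iff ht, hℓ]
    exact (klDiv_tensorPower_ne_top_iff hp hu ht).1 hH
  have hgap := fun i => (hX.integrable_and_integral_driftGap hb htI (f t) hE i).1
  have hBℓ : ∀ i, Integrable (fun x : Config N d => ‖b (x i) (empiricalMeasure x)‖ * |ℓ x|
      / (1 + ‖x‖)) (P.map (X t)) := fun i => by
    refine (integrable_map_measure ?_ hXm.aemeasurable).2 (hgrowth i)
    exact (((measurable_drift hb i).norm.mul hℓC.continuous.measurable.abs).div
      (measurable_const.add measurable_norm)).aestronglyMeasurable
  have hvm : ∀ i, Measurable (particleGradient ℓ i) := fun i =>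
    (continuous_particleGradient (hℓC.of_le one_le_two) i).measurable
  obtain ⟨χ, C, hC, hχ, hχK, hχ01, hχ1, hg1, hg2, hl⟩ := exists_cutoff N d
  obtain ⟨hRi, hR0⟩ := tendsto_integral_cutoff_remainder (ν := P.map (X t)) hC hχ hg1 hg2 hl
    (measurable_drift hb) (measurable_driftGap hb (f t)) hgap hℓC.continuous.measurable hℓi hBℓ
  have hloc := fun n =>
    integral_cutoff_mul_deriv_entropy_density hX hf hb hp hu ht (hχ n) (hχK n) hℓ
  have hsplit : ∀ n x, ∑ i, (χ n x * (⟪driftGap b (f t) i x, particleGradient ℓ i x⟫_ℝ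
          - 1 / 2 * ‖particleGradient ℓ i x‖ ^ 2)
        + ⟪driftGap b (f t) i x, particleGradient (χ n) i x⟫_ℝ
        + ℓ x * ⟪b (x i) (empiricalMeasure x), particleGradient (χ n) i x⟫_ℝ
        + 1 / 2 * (ℓ x * particleLaplacian (χ n) i x))
      - ∑ i, (⟪driftGap b (f t) i x, particleGradient (χ n) i x⟫_ℝ
        + ℓ x * ⟪b (x i) (empiricalMeasure x), particleGradient (χ n) i x⟫_ℝ
        + 1 / 2 * (ℓ x * particleLaplacian (χ n) i x)) =
      χ n x * (∑ i, ⟪driftGap b (f t) i x, particleGradient ℓ i x⟫_ℝ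
        - 1 / 2 * ∑ i, ‖particleGradient ℓ i x‖ ^ 2) := fun n x => by
    rw [← Finset.sum_sub_distrib, Finset.mul_sum, ← Finset.sum_sub_distrib, Finset.mul_sum]
    refine Finset.sum_congr rfl fun i _ => ?_
    ring
  refine integrable_and_integral_eq_of_tendsto_cutoff (χ := χ)
    (S := fun x => ∑ i, ‖driftGap b (f t) i x‖ ^ 2) ?_ ?_
    (fun x => Finset.sum_nonneg fun i _ => sq_nonneg _) (integrable_finsetSum _ fun i _ => hgap i)
    (fun x => Finset.sum_nonneg fun i _ => sq_nonneg _)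
    (fun n => (hχ n).continuous.aestronglyMeasurable) hχ01 hχ1
    (fun a ha x => abs_sum_inner_le ha _ _) (fun n => ?_) ?_
  · exact (Finset.measurable_sum _ fun i _ =>
      (measurable_driftGap hb (f t) i).inner (hvm i)).aestronglyMeasurable
  · exact (Finset.measurable_sum _ fun i _ => (hvm i).norm.pow_const 2).aestronglyMeasurable
  · exact ((hloc n).1.sub (hRi n)).congr (ae_of_all _ (hsplit n))
  -- The truncated dissipation is the cutoff integral of `∂ₜ(p log h)`, which converges by
  -- integrability, minus the remainder, which tends to `0`.
  · simp only [← hsplit]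
    have hlim : Tendsto (fun n => ∫ x, χ n x *
        deriv (fun r => p r x * Real.log (densityRatio p u r x)) t) atTop
        (𝓝 (∫ x, deriv (fun r => p r x * Real.log (densityRatio p u r x)) t)) := by
      refine tendsto_integral_of_dominated_convergence _
        (fun n => (hχ n).continuous.aestronglyMeasurable.mul hint.1) hint.norm
        (fun n => ae_of_all _ fun x => ?_) (ae_of_all _ fun x => ?_)
      · rw [norm_mul, Real.norm_of_nonneg (hχ01 n x).1]
        exact mul_le_of_le_one_left (norm_nonneg _) (hχ01 n x).2
      · simpa using (hχ1 x).mul_const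
          (deriv (fun r => p r x * Real.log (densityRatio p u r x)) t)
    have h := hlim.sub hR0
    rw [sub_zero] at h
    refine h.congr fun n => ?_
    rw [(hloc n).2, integral_sub (hloc n).1 (hRi n)]

end Main

end

theorem lemmaI {N d : ℕ} [NeZero N] {Ω : Type*} {mΩ : MeasurableSpace Ω}
    (P : Measure Ω) [IsProbabilityMeasure P]
    -- the drift, the particle system and the solution of the limit equation
    (b : Space d → ProbabilityMeasure (Space d) → Space d)
    (hb : Measurable (Function.uncurry b)) (T : ℝ)
    (ℱ : Filtration (Icc (0 : ℝ) T) mΩ) (X : ℝ → Ω → Config N d)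
    (hX : IsParticleSystem b T ℱ P X)
    (f : ℝ → ProbabilityMeasure (Space d)) (hf : IsMcKeanVlasovSolution b T f)
    -- regularity of the two flows of laws
    (p : ℝ → Config N d → ℝ) (hp : IsRegularDensity T (fun s => P.map (X s)) p)
    (u : ℝ → Space d → ℝ) (hu : IsRegularDensity T (fun s => (f s : Measure (Space d))) u)
    (t : ℝ) (ht : t ∈ Ioo 0 T)
    -- finite entropy, and a finite mean square in the right-hand side, at time `t`
    (hH : klDiv (P.map (X t)) (tensorPower N (f t)) ≠ ∞)
    (hE : Integrable
      (fun ω => ‖b (X t ω 0) (empiricalMeasure (X t ω)) - b (X t ω 0) (f t)‖ ^ 2) P)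
    -- the time derivative of the entropy density is dominated, locally around `t`
    (hdom : ∃ g : Config N d → ℝ, Integrable g volume ∧ ∀ᶠ s in 𝓝 t, ∀ x,
      |deriv (fun r => p r x * Real.log (densityRatio p u r x)) s| ≤ g x)
    -- growth of the drift against the logarithm of the density ratio (implied by `hH` as soon as
    -- the drift of the particle system has at most linear growth)
    (hgrowth : ∀ i : Fin N, Integrable (fun ω =>
      ‖b (X t ω i) (empiricalMeasure (X t ω))‖ * |Real.log (densityRatio p u t (X t ω))|
        / (1 + ‖X t ω‖)) P) :
    (∀ᶠ s in 𝓝 t, klDiv (P.map (X s)) (tensorPower N (f s)) ≠ ∞) ∧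
    fisherInformation (P.map (X t)) (tensorPower N (f t)) ≠ ∞ ∧
    DifferentiableAt ℝ (fun s => (klDiv (P.map (X s)) (tensorPower N (f s))).toReal) t ∧
    ∀ α : ℝ, 0 < α →
      deriv (fun s => (klDiv (P.map (X s)) (tensorPower N (f s))).toReal) t ≤
        (α - 1) / 2 * (fisherInformation (P.map (X t)) (tensorPower N (f t))).toReal
          + (N : ℝ) / (2 * α) *
            ∫ ω, ‖b (X t ω 0) (empiricalMeasure (X t ω)) - b (X t ω 0) (f t)‖ ^ 2 ∂P := by
  have htI := Ioo_subset_Icc_self ht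
  have hprob : ∀ r ∈ Ioo 0 T, IsProbabilityMeasure (P.map (X r)) := fun r hr =>
    Measure.isProbabilityMeasure_map (hX.measurable (Ioo_subset_Icc_self hr)).aemeasurable
  obtain ⟨hfin, hint, hder⟩ := hasDerivAt_entropy hp hu ht hprob hH hdom
  obtain ⟨hW, hA, hD⟩ :=
    integral_deriv_entropy_density_eq hX hf hb hp hu ht rfl hint hH hE hgrowth
  have hgap := fun i => hX.integrable_and_integral_driftGap hb htI (f t) hE i
  set ℓ : Config N d → ℝ := fun x => Real.log (densityRatio p u t x) with hℓ
  have hW0 : ∀ x, 0 ≤ ∑ i, ‖particleGradient ℓ i x‖ ^ 2 := fun x =>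
    Finset.sum_nonneg fun i _ => sq_nonneg _
  have hI : fisherInformation (P.map (X t)) (tensorPower N (f t)) =
      ENNReal.ofReal (∫ x, ∑ i, ‖particleGradient ℓ i x‖ ^ 2 ∂(P.map (X t))) := by
    rw [fisherInformation_tensorPower hp hu ht,
      ofReal_integral_eq_lintegral_ofReal hW (ae_of_all _ hW0)]
  refine ⟨hfin, hI ▸ ENNReal.ofReal_ne_top, hder.differentiableAt, fun α hα => ?_⟩
  have hS : Integrable (fun x => ∑ i, ‖driftGap b (f t) i x‖ ^ 2) (P.map (X t)) :=
    integrable_finsetSum _ fun i _ => (hgap i).1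
  have hSE : ∫ x, ∑ i, ‖driftGap b (f t) i x‖ ^ 2 ∂(P.map (X t)) =
      N * ∫ ω, ‖b (X t ω 0) (empiricalMeasure (X t ω)) - b (X t ω 0) (f t)‖ ^ 2 ∂P := by
    rw [integral_finsetSum _ fun i _ => (hgap i).1, Finset.sum_congr rfl fun i _ => (hgap i).2]
    simp [driftGap]
  rw [hder.deriv, hD, hI, ENNReal.toReal_ofReal (integral_nonneg hW0)]
  calc ∫ x, (∑ i, ⟪driftGap b (f t) i x, particleGradient ℓ i x⟫_ℝ
        - 1 / 2 * ∑ i, ‖particleGradient ℓ i x‖ ^ 2) ∂(P.map (X t))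
      ≤ ∫ x, ((α - 1) / 2 * ∑ i, ‖particleGradient ℓ i x‖ ^ 2
        + 1 / (2 * α) * ∑ i, ‖driftGap b (f t) i x‖ ^ 2) ∂(P.map (X t)) := by
        refine integral_mono (hA.sub (hW.const_mul _))
          ((hW.const_mul _).add (hS.const_mul _)) fun x => ?_
        -- Young's inequality with parameter `α`: its `α/2` and the dissipation `-1/2` add up to `(α
        -- - 1)/2`.
        have := (abs_le.1 (abs_sum_inner_le hα (fun i => driftGap b (f t) i x)
          fun i => particleGradient ℓ i x)).2
        simp only
        linarith
    _ = _ := by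
        rw [integral_add (hW.const_mul _) (hS.const_mul _), integral_const_mul,
          integral_const_mul, hSE]
        ring
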